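/- Let $Q$ be a finite quiver drawn on the torus $\mathbb{T}^2$ so that the faces are polygons (open discs, with at least two sides each), coloured in blue and red so that the two faces incident to any edge have different colours, and with the edges oriented clockwise around the blue faces. Let $\widetilde Q$ be its lift to the universal cover $\mathbb{R}^2$. Paths and cycles are oriented. A broken wheel is a path obtained by removing one edge $e$ (its interface) from the boundary of a face of $\widetilde Q$; its mirror image is the path obtained by removing $e$ from the boundary of the other face incident to $e$. Assume that $Q$ is shrubby: for any two paths $p\neq p'$ in $\widetilde Q$ with the same start and end points (one of them may be trivial), at least one of $p,p'$ contains a broken wheel whose interface lies in the closed region between $p$ and $p'$. A pre-shrub is a subgraph $S$ of $\widetilde Q$ which does not contain the entire boundary of any face and which, if it contains a broken wheel, also contains its mirror image. A root of $S$ is a maximal vertex, where $u>v$ if there is a path in $S$ from $u$ to $v$. A shrub is a pre-shrub with a single root, below which all its vertices lie (this is automatic if $S$ is finite), and which contains all the vertices in its interior, i.e. in the region completely enclosed by the unoriented cycles of $S$. Let $S$ be a shrub and let $i\notin S$ be a vertex of $\widetilde Q$ such that the number $k$ of edges from vertices of $S$ to $i$ is positive. Let $S+i$ be the subgraph obtained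 from $S$ by adding the vertex $i$ and all edges from $S$ to $i$. Label these edges $e_1,\dots,e_k$ in counterclockwise order around $i$, with $e_{k+1}=e_1$. For each $s$ let $p_s,p'_s$ be simple paths in $S+i$ from a common vertex $j$ to $i$, with last edges $e_s$ and $e_{s+1}$, which intersect only at their endpoints and such that the region $r_s$ between them is minimal with respect to inclusion. Choose the labelling so that $r_k$ is the region which does not contain the counterclockwise angle at $i$ from $e_k$ to $e_1$ (if $k=1$, the region $r_1$ is reduced to a path). An index $s<k$ is good if $p_s$ and $p'_s$ are broken wheels which are mirror images of each other; the index $s=k$ is good if there are no edges from $i$ to $S$ in the counterclockwise angle from $e_k$ to $e_1$ (for $k=1$: no edges from $i$ to $S$ at all). The vertex $i$ is addable to $S$ if all $s\in\{1,\dots,k\}$ are good. Then $S+i$ is a shrub if and only if $i$ is addable to $S$. -/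

import Mathlib

/-- A quiver (vertices `V`, edges `E`) drawn on an oriented surface without boundary, whose faces
are polygons coloured in blue and red so that the two faces incident to an edge have different
colours, with the edges oriented clockwise around the blue faces (hence counterclockwise around the
red ones).  Thus the blue face of an edge lies on its right and the red face on its left.
`blue e` is the edge that follows `e` on the boundary of the blue face of `e`, and `red e` the edge
that follows `e` on the boundary of its red face.  So the blue (red) faces are the cycles of the
permutation `blue` (`red`). -/
structure BicoloredQuiver (V E : Type*) where
  src : E → V
  tgt : E → V
  blue : Equiv.Perm E
  red : Equiv.Perm E
  src_blue : ∀ e, src (blue e) = tgt e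
  src_red : ∀ e, src (red e) = tgt e
  /-- No face is bounded by a single loop. -/
  blue_ne : ∀ e, blue e ≠ e
  red_ne : ∀ e, red e ≠ e
  /-- Going counterclockwise around the end point of an edge `e`, one meets `e`, then the edge
  `blue e` leaving that point, then the incoming edge `red⁻¹ (blue e)`, and so on; one full turn
  runs through all the edges that end there. -/
  single_vertex : ∀ e f, tgt e = tgt f → (red⁻¹ * blue).SameCycle e f

namespace BicoloredQuiver

variable {V E : Type*} (M : BicoloredQuiver V E)

/-- The next incoming edge after `e`, counterclockwise around the end point of `e`. -/
def ccw : Equiv.Perm E := M.red⁻¹ * M.blue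

/-! ### Faces -/

/-- The faces: the blue ones and the red ones. -/
abbrev Face : Type _ :=
  Quotient (Equiv.Perm.SameCycle.setoid M.blue) ⊕ Quotient (Equiv.Perm.SameCycle.setoid M.red)

/-- The blue face of an edge. -/
def rightFace (e : E) : M.Face := Sum.inl (Quotient.mk _ e)

/-- The red face of an edge. -/
def leftFace (e : E) : M.Face := Sum.inr (Quotient.mk _ e)

/-- The edges on the boundary of a face. -/
def boundary (F : M.Face) : Set E := {e | M.rightFace e = F ∨ M.leftFace e = F}

/-- The boundary of the blue face of `e`, as a closed path that starts with `e`. -/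
noncomputable def blueLoop (e : E) : List E :=
  List.iterate M.blue e (Function.minimalPeriod M.blue e)

/-- The boundary of the red face of `e`, as a closed path that starts with `e`. -/
noncomputable def redLoop (e : E) : List E :=
  List.iterate M.red e (Function.minimalPeriod M.red e)

/-- The broken wheel with interface `e` in the blue face of `e`: the path obtained by removing `e`
from the boundary of that face. -/
noncomputable def blueWheel (e : E) : List E := (M.blueLoop e).tail

/-- The broken wheel with interface `e` in the red face of `e`.  The broken wheels `blueWheel e`
and `redWheel e` are the mirror images of each other. -/
noncomputable def redWheel (e : E) : List E := (M.redLoop e).tail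

/-! ### Oriented paths, unoriented walks, simple connectedness -/

/-- `p` is an (oriented) path from `u` to `v`. -/
def IsPath (u v : V) : List E → Prop
  | [] => u = v
  | e :: p => M.src e = u ∧ IsPath (M.tgt e) v p

/-- `w` is an unoriented walk from `u` to `v`: `(e, true)` stands for the edge `e` run through
forwards, and `(e, false)` for `e` run through backwards. -/
def IsWalk (u v : V) : List (E × Bool) → Prop
  | [] => u = v
  | (e, true) :: w => M.src e = u ∧ IsWalk (M.tgt e) v w
  | (e, false) :: w => M.tgt e = u ∧ IsWalk (M.src e) v w

/-- Elementary homotopies of walks: inserting an edge followed by its reverse, or inserting the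
boundary of a face. -/
inductive HomotopyStep : List (E × Bool) → List (E × Bool) → Prop
  | backtrack (a b : List (E × Bool)) (e : E) (x : Bool) :
      HomotopyStep (a ++ b) (a ++ [(e, x), (e, !x)] ++ b)
  | blue (a b : List (E × Bool)) (e : E) :
      HomotopyStep (a ++ b) (a ++ (M.blueLoop e).map (fun f => (f, true)) ++ b)
  | red (a b : List (E × Bool)) (e : E) :
      HomotopyStep (a ++ b) (a ++ (M.redLoop e).map (fun f => (f, true)) ++ b)

/-- Homotopy of closed walks based at `v`. -/
def Homotopic (v : V) : List (E × Bool) → List (E × Bool) → Prop :=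
  Relation.EqvGen (fun w w' => M.IsWalk v v w ∧ M.IsWalk v v w' ∧ M.HomotopyStep w w')

/-- The surface on which the quiver is drawn is connected. -/
def Connected : Prop := ∀ u v, ∃ w, M.IsWalk u v w

/-- Every closed walk can be contracted across the faces. -/
def SimplyConnected : Prop := ∀ v w, M.IsWalk v v w → M.Homotopic v w []

/-! ### Regions of the plane -/

/-- Two faces share an edge that does not belong to `A`. -/
def Crossing (A : Set E) (F G : M.Face) : Prop :=
  ∃ e, e ∉ A ∧ ((F = M.leftFace e ∧ G = M.rightFace e) ∨ (F = M.rightFace e ∧ G = M.leftFace e))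

/-- The faces enclosed by the edges in `A`: those which lie in a bounded connected component of the
complement of `A` in the plane, that is, from which only finitely many faces can be reached without
crossing an edge of `A`. -/
def enclosed (A : Set E) : Set M.Face :=
  {F | {G | Relation.ReflTransGen (M.Crossing A) F G}.Finite}

/-- The faces in the region between the paths `p` and `p'`. -/
def region (p p' : List E) : Set M.Face := M.enclosed {e | e ∈ p ∨ e ∈ p'}

/-- The quiver (in the plane) has the property that, for any two different paths `p`, `p'` with the
same start and end points, at least one of `p` and `p'` contains a broken wheel whose interface `e`
lies in the closed region between `p` and `p'`. -/
def Shrubby : Prop :=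
  ∀ (u v : V) (p p' : List E), M.IsPath u v p → M.IsPath u v p' → p ≠ p' →
    ∃ e, (M.leftFace e ∈ M.region p p' ∨ M.rightFace e ∈ M.region p p') ∧
      (M.blueWheel e ⊆ p ∨ M.redWheel e ⊆ p ∨ M.blueWheel e ⊆ p' ∨ M.redWheel e ⊆ p')

/-! ### Subgraphs and shrubs -/

/-- Subgraphs of the quiver. -/
@[ext] structure Subgraph where
  verts : Set V
  edges : Set E
  src_mem : ∀ e ∈ edges, M.src e ∈ verts
  tgt_mem : ∀ e ∈ edges, M.tgt e ∈ verts

variable {M}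

namespace Subgraph

variable (S : M.Subgraph)

/-- A pre-shrub does not contain the entire boundary of any face, and if it contains a broken wheel
then it also contains its mirror image. -/
def IsPreShrub : Prop :=
  (∀ F : M.Face, ¬ M.boundary F ⊆ S.edges) ∧
  ∀ e, (∀ f ∈ M.blueWheel e, f ∈ S.edges) ↔ (∀ f ∈ M.redWheel e, f ∈ S.edges)

/-- There is a path in `S` from `u` to `v`. -/
def Reaches (u v : V) : Prop := ∃ p : List E, M.IsPath u v p ∧ ∀ e ∈ p, e ∈ S.edges

/-- A root is a maximal vertex, where `u > v` if there is a path in `S` from `u` to `v`. -/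
def IsRoot (r : V) : Prop := r ∈ S.verts ∧ ∀ v ∈ S.verts, S.Reaches v r → v = r

/-- The vertices in the interior of `S`, i.e. in the region completely enclosed by the unoriented
cycles of `S`: all the faces around the vertex are enclosed by `S`. -/
def interior : Set V :=
  {v | ∀ e, (M.src e = v ∨ M.tgt e = v) →
    M.rightFace e ∈ M.enclosed S.edges ∧ M.leftFace e ∈ M.enclosed S.edges}

/-- A shrub is a pre-shrub with a single root which contains all the vertices in its interior.
The third clause, that every vertex lies below a root, holds automatically if `S` is finite (and has
no oriented cycles). -/
def IsShrub : Prop :=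
  S.IsPreShrub ∧ (∃! r, S.IsRoot r) ∧ (∀ v ∈ S.verts, ∃ r, S.IsRoot r ∧ S.Reaches r v) ∧
    S.interior ⊆ S.verts

/-- The edges from `S` to the vertex `i`. -/
def edgesTo (i : V) : Set E := {e | M.src e ∈ S.verts ∧ M.tgt e = i}

/-- `S + i`: the vertex `i` and all the edges from `S` to `i` are added to `S`. -/
def add (i : V) : M.Subgraph where
  verts := insert i S.verts
  edges := S.edges ∪ S.edgesTo i
  src_mem := by
    rintro e (he | he)
    · exact Set.mem_insert_of_mem _ (S.src_mem e he)
    · exact Set.mem_insert_of_mem _ he.1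
  tgt_mem := by
    rintro e (he | he)
    · exact Set.mem_insert_of_mem _ (S.tgt_mem e he)
    · exact he.2 ▸ Set.mem_insert _ _

/-! ### Addable vertices -/

/-- `e` and `e'` are consecutive among the edges from `S` to `i`, in counterclockwise order around
`i`: the edge `e'` is the first edge from `S` that is met after `e`, and this happens at the `n`-th
incoming edge (`n > 0`) after `e`.  If there is only one edge from `S` to `i`, then `e' = e`, after a
full turn. -/
def Consecutive (i : V) (e e' : E) (n : ℕ) : Prop :=
  e ∈ S.edgesTo i ∧ e' ∈ S.edgesTo i ∧ 0 < n ∧ (M.ccw ^ n) e = e' ∧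
    ∀ m, 0 < m → m < n → (M.ccw ^ m) e ∉ S.edgesTo i

/-- `p` and `p'` are simple paths in `S + i` from a common vertex `j` to `i`, whose last edges are
`e` and `e'` respectively, and which do not intersect except at their endpoints. -/
def JoiningPaths (i : V) (e e' : E) (p p' : List E) : Prop :=
  ∃ j, M.IsPath j i p ∧ M.IsPath j i p' ∧
    (∀ f ∈ p, f ∈ (S.add i).edges) ∧ (∀ f ∈ p', f ∈ (S.add i).edges) ∧
    p.getLast? = some e ∧ p'.getLast? = some e' ∧
    (p.map M.src ++ [i]).Nodup ∧ (p'.map M.src ++ [i]).Nodup ∧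
    ∀ v, v ∈ p.map M.src → v ∈ p'.map M.src → v = j

/-- Joining paths such that the region between them is minimal with respect to inclusion. -/
def MinimalJoiningPaths (i : V) (e e' : E) (p p' : List E) : Prop :=
  S.JoiningPaths i e e' p p' ∧
    ∀ q q', S.JoiningPaths i e e' q q' →
      M.region q q' ⊆ M.region p p' → M.region p p' ⊆ M.region q q'

/-- The consecutive pair `e`, `e'` is the last one, `(e_k, e_1)`: the region between the minimal
joining paths does not contain the counterclockwise angle at `i` from `e` to `e'`, which begins
with the face on the right of `e`.  If `k = 1` then the region is reduced to a path. -/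
def IsLastPair (i : V) (e e' : E) : Prop :=
  e = e' ∨ ∃ p p', S.MinimalJoiningPaths i e e' p p' ∧ M.rightFace e ∉ M.region p p'

/-- The consecutive pair `e`, `e'` is good.  For the last pair this means that there are no edges
from `i` to `S` in the counterclockwise angle from `e` to `e'`; for the other pairs it means that the
minimal joining paths are broken wheels which are mirror images of each other. -/
def Good (i : V) (e e' : E) (n : ℕ) : Prop :=
  (S.IsLastPair i e e' ∧ ∀ m < n, M.tgt (M.blue ((M.ccw ^ m) e)) ∉ S.verts) ∨
  (¬ S.IsLastPair i e e' ∧ ∃ p p', S.MinimalJoiningPaths i e e' p p' ∧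
    ∃ h, (p = M.blueWheel h ∧ p' = M.redWheel h) ∨ (p = M.redWheel h ∧ p' = M.blueWheel h))

/-- The vertex `i` is addable to `S` if all pairs of consecutive edges from `S` to `i` are good. -/
def Addable (i : V) : Prop := ∀ e e' n, S.Consecutive i e e' n → S.Good i e e' n

end Subgraph

end BicoloredQuiver

/-- A bicoloured quiver together with the translations of its lift to a `ℤ²`-cover: once a lift of
every vertex is chosen, the lift of the edge `e` that starts at the chosen lift of its source ends
at the translate by `shift e` of the chosen lift of its target.  The lift of the boundary of a face
closes up. -/
structure PeriodicQuiver (I E : Type*) extends BicoloredQuiver I E where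
  shift : E → ℤ × ℤ
  blue_closed : ∀ e, ∑ k ∈ Finset.range (Function.minimalPeriod blue e),
    shift ((blue : E → E)^[k] e) = 0
  red_closed : ∀ e, ∑ k ∈ Finset.range (Function.minimalPeriod red e),
    shift ((red : E → E)^[k] e) = 0

namespace PeriodicQuiver

variable {I E : Type*} (Q : PeriodicQuiver I E)

/-- Lift of a permutation of the edges: `(e, n)` goes to `(π e, n + shift e)`. -/
def liftPerm (π : Equiv.Perm E) : Equiv.Perm (E × (ℤ × ℤ)) where
  toFun x := (π x.1, x.2 + Q.shift x.1)
  invFun x := (π.symm x.1, x.2 - Q.shift (π.symm x.1))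
  left_inv x := by simp
  right_inv x := by simp

theorem ccw_liftPerm_pow (k : ℕ) (x : E × (ℤ × ℤ)) :
    (((Q.liftPerm Q.red)⁻¹ * Q.liftPerm Q.blue) ^ k) x =
      (((Q.red⁻¹ * Q.blue) ^ k) x.1,
        x.2 + Q.shift x.1 - Q.shift (((Q.red⁻¹ * Q.blue) ^ k) x.1)) := by
  induction k with
  | zero => simp
  | succ k ih =>
    rw [pow_succ', Equiv.Perm.mul_apply, ih, pow_succ', Equiv.Perm.mul_apply]
    have hinv : ∀ y : E × (ℤ × ℤ), (Q.liftPerm Q.red)⁻¹ y =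
        (Q.red⁻¹ y.1, y.2 - Q.shift (Q.red⁻¹ y.1)) := fun _ => rfl
    have hblue : ∀ y : E × (ℤ × ℤ), Q.liftPerm Q.blue y = (Q.blue y.1, y.2 + Q.shift y.1) :=
      fun _ => rfl
    rw [Equiv.Perm.mul_apply, hblue, hinv]
    simp

theorem ccw_liftPerm_eq {e f : E} {m n : ℤ × ℤ} (h : m + Q.shift e = n + Q.shift f) {k : ℕ}
    (hk : ((Q.red⁻¹ * Q.blue) ^ k) e = f) :
    (((Q.liftPerm Q.red)⁻¹ * Q.liftPerm Q.blue) ^ k) (e, m) = (f, n) := by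
  rw [ccw_liftPerm_pow]
  simp only [hk, h, add_sub_cancel_right]

/-- The `ℤ²`-cover: the edge `(e, n)` is the translate by `n` of the chosen lift of `e`. -/
def cover : BicoloredQuiver (I × (ℤ × ℤ)) (E × (ℤ × ℤ)) where
  src x := (Q.src x.1, x.2)
  tgt x := (Q.tgt x.1, x.2 + Q.shift x.1)
  blue := Q.liftPerm Q.blue
  red := Q.liftPerm Q.red
  src_blue x := by simp [liftPerm, Q.src_blue]
  src_red x := by simp [liftPerm, Q.src_red]
  blue_ne x h := Q.blue_ne x.1 (congrArg Prod.fst h)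
  red_ne x h := Q.red_ne x.1 (congrArg Prod.fst h)
  single_vertex := by
    rintro ⟨e, m⟩ ⟨f, n⟩ h
    have h1 : Q.tgt e = Q.tgt f := congrArg Prod.fst h
    have h2 : m + Q.shift e = n + Q.shift f := congrArg Prod.snd h
    obtain ⟨z, hz⟩ := Q.single_vertex e f h1
    obtain ⟨k, rfl | rfl⟩ := z.eq_nat_or_neg
    · exact ⟨k, by rw [zpow_natCast] at hz ⊢; exact Q.ccw_liftPerm_eq h2 hz⟩
    · refine Equiv.Perm.SameCycle.symm ⟨k, ?_⟩
      rw [zpow_neg, zpow_natCast, Equiv.Perm.inv_eq_iff_eq] at hz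
      rw [zpow_natCast]
      exact Q.ccw_liftPerm_eq h2.symm hz.symm

end PeriodicQuiver

/-- A finite quiver drawn on the torus `ℝ²/ℤ²`, with polygonal faces coloured in blue and red, edges
oriented clockwise around the blue faces.  The `ℤ²`-cover is connected and simply connected; so it is
the universal cover, the plane, and the surface on which the quiver itself is drawn, being its
quotient by `ℤ²`, is the torus. -/
structure TorusQuiver (I E : Type*) [Finite I] [Finite E] extends PeriodicQuiver I E where
  cover_connected : toPeriodicQuiver.cover.Connected
  cover_simplyConnected : toPeriodicQuiver.cover.SimplyConnected

namespace TorusQuiver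

variable {I E : Type*} [Finite I] [Finite E]

/-- The lift of the quiver to the universal cover of the torus. -/
abbrev universalCover (Q : TorusQuiver I E) : BicoloredQuiver (I × (ℤ × ℤ)) (E × (ℤ × ℤ)) :=
  Q.toPeriodicQuiver.cover

/-- `Q` is shrubby. -/
def IsShrubby (Q : TorusQuiver I E) : Prop := Q.universalCover.Shrubby

end TorusQuiver

namespace BicoloredQuiver

/-- A bicoloured quiver on a surface that behaves like the plane: connected, simply connected, with
finite faces, finite valencies and infinitely many faces. -/
structure IsPlanar {V E : Type*} (M : BicoloredQuiver V E) : Prop where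
  blue_periodic : ∀ e, e ∈ Function.periodicPts M.blue
  red_periodic : ∀ e, e ∈ Function.periodicPts M.red
  finite_in : ∀ v, {e | M.tgt e = v}.Finite
  connected : M.Connected
  simplyConnected : M.SimplyConnected
  infinite_face : Infinite M.Face

variable {V E : Type*} {M : BicoloredQuiver V E}

/-! ### Paths -/

theorem isPath_append {u v : V} {p q : List E} :
    M.IsPath u v (p ++ q) ↔ ∃ x, M.IsPath u x p ∧ M.IsPath x v q := by
  induction p generalizing u with
  | nil => simp [IsPath]
  | cons e p ih => simp [IsPath, ih, and_assoc]

theorem IsPath.cons_map_tgt {u v : V} {p : List E} (h : M.IsPath u v p) :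
    u :: p.map M.tgt = p.map M.src ++ [v] := by
  induction p generalizing u with
  | nil => simpa [IsPath] using h
  | cons e p ih =>
    obtain ⟨rfl, h⟩ := h
    simpa using ih h

theorem IsPath.split_src {u v : V} {p : List E} (h : M.IsPath u v p) {x : V}
    (hx : x ∈ p.map M.src) : ∃ a b, p = a ++ b ∧ b ≠ [] ∧ M.IsPath u x a ∧ M.IsPath x v b := by
  obtain ⟨e, he, rfl⟩ := List.mem_map.1 hx
  obtain ⟨a, b, rfl⟩ := List.append_of_mem he
  obtain ⟨y, ha, hy, hb⟩ := isPath_append.1 h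
  exact ⟨a, e :: b, rfl, by simp, hy ▸ ha, rfl, hb⟩

theorem IsPath.split_tgt {u v : V} {p : List E} (h : M.IsPath u v p) {x : V}
    (hx : x ∈ p.map M.tgt) : ∃ a b, p = a ++ b ∧ a ≠ [] ∧ M.IsPath u x a ∧ M.IsPath x v b := by
  obtain ⟨e, he, rfl⟩ := List.mem_map.1 hx
  obtain ⟨a, b, rfl⟩ := List.append_of_mem he
  obtain ⟨y, ha, hy, hb⟩ := isPath_append.1 h
  exact ⟨a ++ [e], b, by simp, by simp, isPath_append.2 ⟨y, ha, hy, rfl⟩, hb⟩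

theorem IsPath.tgt_of_getLast? {u v : V} {p : List E} (h : M.IsPath u v p) {e : E}
    (he : p.getLast? = some e) : M.tgt e = v := by
  obtain ⟨q, rfl⟩ := List.getLast?_eq_some_iff.1 he
  obtain ⟨x, -, -, h⟩ := isPath_append.1 h
  exact h

/-! ### The two colours -/

variable (M) in
/-- The edge that follows `e` on the boundary of its face of colour `b`; `true` is blue. -/
def next (b : Bool) : Equiv.Perm E := if b then M.blue else M.red

variable (M) in
/-- The face of `e` of colour `b`; `true` is blue. -/
def face (b : Bool) (e : E) : M.Face := if b then M.rightFace e else M.leftFace e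

variable (M) in
/-- The broken wheel with interface `e` in the face of `e` of colour `b`; `true` is blue. -/
noncomputable def wheel (b : Bool) (e : E) : List E := if b then M.blueWheel e else M.redWheel e

theorem wheel_eq (b : Bool) (e : E) : M.wheel b e =
    (List.iterate (M.next b) e (Function.minimalPeriod (M.next b) e)).tail := by
  cases b <;> rfl

theorem src_next (b : Bool) (e : E) : M.src (M.next b e) = M.tgt e := by
  cases b
  exacts [M.src_red e, M.src_blue e]

theorem next_ne (b : Bool) (e : E) : M.next b e ≠ e := by
  cases b
  exacts [M.red_ne e, M.blue_ne e]

theorem face_eq_iff {b : Bool} {e f : E} : M.face b e = M.face b f ↔ (M.next b).SameCycle e f := by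
  cases b
  · exact Sum.inr_injective.eq_iff.trans Quotient.eq
  · exact Sum.inl_injective.eq_iff.trans Quotient.eq

theorem face_next (b : Bool) (e : E) : M.face b (M.next b e) = M.face b e :=
  face_eq_iff.2 (Equiv.Perm.sameCycle_apply_left.2 (Equiv.Perm.SameCycle.refl _ _))

theorem face_ne (b : Bool) (e f : E) : M.face b e ≠ M.face (!b) f := by
  cases b <;> simp [face, rightFace, leftFace]

theorem leftFace_ne_rightFace (e f : E) : M.leftFace e ≠ M.rightFace f := face_ne false e f

theorem leftFace_eq_or {b : Bool} {e : E} {P : M.Face → Prop} (h : P (M.face b e)) :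
    P (M.leftFace e) ∨ P (M.rightFace e) := by
  cases b
  exacts [Or.inl h, Or.inr h]

theorem isPath_iterate {π : Equiv.Perm E} (hπ : ∀ e, M.src (π e) = M.tgt e) (e : E) (n : ℕ) :
    M.IsPath (M.src e) (M.src (π^[n] e)) (List.iterate π e n) := by
  induction n generalizing e with
  | zero => rfl
  | succ n ih => exact ⟨rfl, hπ e ▸ ih (π e)⟩

theorem exists_iterate_eq_of_sameCycle {π : Equiv.Perm E} {e f : E}
    (he : e ∈ Function.periodicPts π) (h : π.SameCycle e f) :
    ∃ m < Function.minimalPeriod π e, f = π^[m] e := by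
  obtain ⟨z, rfl⟩ := h
  have hN := Function.iterate_minimalPeriod (f := π) (x := e)
  have hN0 : (0 : ℤ) < Function.minimalPeriod π e := by
    exact_mod_cast Function.minimalPeriod_pos_of_mem_periodicPts he
  set N := Function.minimalPeriod π e
  rw [Equiv.Perm.iterate_eq_pow] at hN
  refine ⟨(z % N).toNat, ?_, ?_⟩
  · have := Int.emod_lt_of_pos z hN0
    omega
  · rw [Equiv.Perm.iterate_eq_pow, ← zpow_natCast, Int.toNat_of_nonneg (Int.emod_nonneg _ hN0.ne')]
    conv_lhs => rw [← Int.emod_add_mul_ediv z N, zpow_add, zpow_mul, Equiv.Perm.mul_apply,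
      zpow_natCast, Equiv.Perm.zpow_apply_eq_self_of_apply_eq_self hN]

/-! ### Broken wheels as paths -/

namespace IsPlanar

variable (hM : M.IsPlanar)
include hM

theorem next_periodic (b : Bool) (e : E) : e ∈ Function.periodicPts (M.next b) := by
  cases b
  exacts [hM.red_periodic e, hM.blue_periodic e]

theorem loop_eq (b : Bool) (e : E) :
    List.iterate (M.next b) e (Function.minimalPeriod (M.next b) e) = e :: M.wheel b e := by
  rw [wheel_eq]
  obtain ⟨n, hn⟩ := Nat.exists_eq_succ_of_ne_zero
    (Function.minimalPeriod_pos_of_mem_periodicPts (hM.next_periodic b e)).ne'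
  simp [hn, List.iterate]

theorem mem_loop {b : Bool} {e f : E} : f ∈ e :: M.wheel b e ↔ M.face b f = M.face b e := by
  rw [← hM.loop_eq, List.mem_iterate, face_eq_iff]
  constructor
  · rintro ⟨m, -, rfl⟩
    exact Equiv.Perm.SameCycle.symm ⟨m, by simp [Equiv.Perm.iterate_eq_pow]⟩
  · exact fun h => exists_iterate_eq_of_sameCycle (hM.next_periodic b e) h.symm

theorem loop_nodup (b : Bool) (e : E) : (e :: M.wheel b e).Nodup := by
  rw [← hM.loop_eq, ← List.range_map_iterate]
  refine (List.nodup_range).map_on fun x hx y hy h => ?_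
  exact Function.iterate_injOn_Iio_minimalPeriod (by simpa using hx) (by simpa using hy) h

theorem mem_wheel {b : Bool} {e f : E} : f ∈ M.wheel b e ↔ M.face b f = M.face b e ∧ f ≠ e := by
  rw [← hM.mem_loop, List.mem_cons]
  have := List.nodup_cons.1 (hM.loop_nodup b e)
  constructor
  · intro h
    exact ⟨Or.inr h, fun h' => this.1 (h' ▸ h)⟩
  · rintro ⟨h | h, h'⟩
    exacts [absurd h h', h]

theorem wheel_nodup (b : Bool) (e : E) : (M.wheel b e).Nodup :=
  (List.nodup_cons.1 (hM.loop_nodup b e)).2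

theorem next_mem_wheel (b : Bool) (e : E) : M.next b e ∈ M.wheel b e :=
  hM.mem_wheel.2 ⟨face_next b e, next_ne b e⟩

theorem wheel_ne_nil (b : Bool) (e : E) : M.wheel b e ≠ [] :=
  List.ne_nil_of_mem (hM.next_mem_wheel b e)

theorem isPath_wheel (b : Bool) (e : E) : M.IsPath (M.tgt e) (M.src e) (M.wheel b e) := by
  have h := isPath_iterate (src_next (M := M) b) e (Function.minimalPeriod (M.next b) e)
  rw [Function.iterate_minimalPeriod, hM.loop_eq] at h
  exact h.2

theorem getLast?_wheel (b : Bool) (e : E) : (M.wheel b e).getLast? = some ((M.next b).symm e) := by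
  have h1 : (M.wheel b e).getLast? = (e :: M.wheel b e).getLast? := by
    obtain ⟨a, l, h⟩ := List.exists_cons_of_ne_nil (hM.wheel_ne_nil b e)
    simp [h]
  have hp := Function.minimalPeriod_pos_of_mem_periodicPts (hM.next_periodic b e)
  have hN := Function.iterate_minimalPeriod (f := M.next b) (x := e)
  rw [h1, ← hM.loop_eq, ← List.range_map_iterate]
  obtain ⟨n, hn⟩ := Nat.exists_eq_succ_of_ne_zero hp.ne'
  rw [hn] at hN ⊢
  rw [List.range_succ, List.map_append, List.map_singleton, List.getLast?_concat]
  exact congrArg some ((Equiv.eq_symm_apply _).2 (Function.iterate_succ_apply' (M.next b) n e ▸ hN))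

theorem next_mem_wheel_or {b : Bool} {e f : E} (hf : f ∈ M.wheel b e) :
    M.next b f = e ∨ M.next b f ∈ M.wheel b e := by
  rw [hM.mem_wheel] at hf ⊢
  by_cases h : M.next b f = e
  · exact Or.inl h
  · exact Or.inr ⟨(face_next b f).trans hf.1, h⟩

end IsPlanar

/-! ### Winding numbers -/

variable (M) in
/-- The coboundary of a function on the faces. -/
def jump (c : M.Face → ℤ) (f : E) : ℤ := c (M.leftFace f) - c (M.rightFace f)

open Classical in
/-- How often a walk runs through an edge, counted with signs. -/
noncomputable def traversals (w : List (E × Bool)) (f : E) : ℤ :=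
  (w.count (f, true) : ℤ) - w.count (f, false)

theorem traversals_append (w w' : List (E × Bool)) (f : E) :
    traversals (w ++ w') f = traversals w f + traversals w' f := by
  simp only [traversals, List.count_append]
  push_cast
  ring

theorem traversals_backtrack (e : E) (x : Bool) (f : E) :
    traversals [(e, x), (e, !x)] f = 0 := by
  by_cases h : e = f <;> cases x <;> simp [traversals, h]

theorem traversals_eq_zero {w : List (E × Bool)} {f : E} (h : f ∉ w.map Prod.fst) :
    traversals w f = 0 := by
  have (x : Bool) : (f, x) ∉ w := fun hx => h (List.mem_map_of_mem (f := Prod.fst) hx)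
  simp [traversals, List.count_eq_zero_of_not_mem, this]

theorem traversals_of_nodup {w : List (E × Bool)} (hw : (w.map Prod.fst).Nodup) {e : E} {x : Bool}
    (h : (e, x) ∈ w) : traversals w e = if x then 1 else -1 := by
  classical
  have h1 := List.count_eq_one_of_mem hw.of_map h
  have h2 : (e, !x) ∉ w := fun h' => by
    have := List.inj_on_of_nodup_map hw h h' rfl
    simp at this
  have h2 := List.count_eq_zero_of_not_mem h2
  cases x <;> simp only [Bool.not_true, Bool.not_false] at h2 <;> simp [traversals, h1, h2]

-- The loop runs once through each edge of its face, with the face on its left if it is red and on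
-- its right if it is blue; hence the weights `1` and `-1`.
open Classical in
theorem IsPlanar.traversals_loop (hM : M.IsPlanar) (b : Bool) (e f : E) :
    traversals ((e :: M.wheel b e).map (fun g => (g, true))) f =
      M.jump (fun F => if F = M.face b e then (if b then -1 else 1) else 0) f := by
  have h1 : traversals ((e :: M.wheel b e).map (fun g => (g, true))) f =
      if M.face b f = M.face b e then 1 else 0 := by
    split_ifs with h
    · refine traversals_of_nodup (x := true) ?_
        (List.mem_map_of_mem (f := fun g => (g, true)) (hM.mem_loop.2 h))
      simpa [Function.comp_def] using hM.loop_nodup b e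
    · refine traversals_eq_zero ?_
      rw [← hM.mem_loop] at h
      simpa [Function.comp_def] using h
  rw [h1]
  have hlr := leftFace_ne_rightFace (M := M)
  cases b
  · simp [jump, face, (hlr _ _).symm]
  · simp only [jump, face, hlr, if_true, if_false]
    split_ifs <;> simp

/-- An elementary homotopy changes the traversals by nothing or by a face boundary, which is a
coboundary. Every closed walk is homotopic to the trivial one, so its traversals form a coboundary
as well. -/
theorem IsPlanar.exists_winding (hM : M.IsPlanar) {v : V} {w : List (E × Bool)}
    (hw : M.IsWalk v v w) :
    ∃ c : M.Face → ℤ, c.support.Finite ∧ ∀ f, M.jump c f = traversals w f := by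
  classical
  have key : ∀ w w', M.Homotopic v w w' → ∃ c : M.Face → ℤ, c.support.Finite ∧
      ∀ f, M.jump c f = traversals w f - traversals w' f := by
    intro w w' h
    induction h with
    | rel w w' h =>
      have hloop : ∀ (b : Bool) (p q : List (E × Bool)) (e : E), ∃ c : M.Face → ℤ,
          c.support.Finite ∧ ∀ f, M.jump c f = traversals (p ++ q) f -
            traversals (p ++ (e :: M.wheel b e).map (fun f => (f, true)) ++ q) f := by
        intro b p q e
        refine ⟨-fun F => if F = M.face b e then (if b then -1 else 1) else 0, ?_, fun f => ?_⟩
        · refine (Set.finite_singleton (M.face b e)).subset fun F hF => ?_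
          by_contra h
          simp_all
        · rw [traversals_append, traversals_append, traversals_append, hM.traversals_loop]
          simp only [jump, Pi.neg_apply]
          ring
      obtain ⟨-, -, h⟩ := h
      cases h with
      | backtrack p q e x =>
        refine ⟨0, by simp, fun f => ?_⟩
        rw [traversals_append, traversals_append, traversals_append, traversals_backtrack]
        simp [jump]
      | blue p q e =>
        have := hloop true p q e
        rwa [← hM.loop_eq] at this
      | red p q e =>
        have := hloop false p q e
        rwa [← hM.loop_eq] at this
    | refl w => exact ⟨0, by simp, fun f => by simp [jump]⟩
    | symm w w' _ ih =>
      obtain ⟨c, hc, h⟩ := ih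
      refine ⟨-c, by simpa using hc, fun f => ?_⟩
      have := h f
      simp only [jump, Pi.neg_apply] at this ⊢
      linarith
    | trans w w' w'' _ _ ih ih' =>
      obtain ⟨c, hc, h⟩ := ih
      obtain ⟨c', hc', h'⟩ := ih'
      refine ⟨c + c', (hc.union hc').subset (Function.support_add c c'), fun f => ?_⟩
      have := h f
      have := h' f
      simp only [jump, Pi.add_apply] at *
      linarith
  obtain ⟨c, hc, h⟩ := key w [] (hM.simplyConnected v w hw)
  exact ⟨c, hc, fun f => by simpa [traversals] using h f⟩

/-- A finitely supported function on the faces without jumps vanishes. -/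
theorem IsPlanar.eq_zero_of_jump (hM : M.IsPlanar) {c : M.Face → ℤ} (hc : c.support.Finite)
    (h : ∀ f, M.jump c f = 0) : c = 0 := by
  -- Equal values across each edge propagate around every vertex, then along walks, so `c` is
  -- constant; a nonzero constant has infinite support.
  have hlr : ∀ f, c (M.leftFace f) = c (M.rightFace f) := fun f => sub_eq_zero.1 (h f)
  have hblue : ∀ e, c (M.rightFace (M.blue e)) = c (M.rightFace e) := fun e =>
    congrArg c (face_next true e)
  have hred : ∀ e, c (M.rightFace (M.red e)) = c (M.rightFace e) := fun e => by
    rw [← hlr, ← hlr]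
    exact congrArg c (face_next false e)
  have hccw : ∀ e, c (M.rightFace (M.ccw e)) = c (M.rightFace e) := fun e => by
    rw [← hred, ← hblue e]
    simp [ccw]
  have hcyc : ∀ {e f}, M.ccw.SameCycle e f → c (M.rightFace e) = c (M.rightFace f) := by
    rintro e f ⟨z, rfl⟩
    induction z with
    | zero => rfl
    | succ n ih => rw [ih, add_comm, zpow_add, Equiv.Perm.mul_apply, zpow_one, hccw]
    | pred n ih =>
      rw [ih, ← hccw ((M.ccw ^ (-(n : ℤ) - 1)) e), ← Equiv.Perm.mul_apply, ← zpow_one_add]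
      congr 4
      ring
  have hvert : ∀ e f, M.src e = M.src f → c (M.rightFace e) = c (M.rightFace f) := by
    intro e f hef
    obtain ⟨e', rfl⟩ := M.blue.surjective e
    obtain ⟨f', rfl⟩ := M.blue.surjective f
    rw [M.src_blue, M.src_blue] at hef
    rw [hblue, hblue]
    exact hcyc (M.single_vertex _ _ hef)
  have hwalk : ∀ w u v, M.IsWalk u v w → ∀ e f, M.src e = u → M.src f = v →
      c (M.rightFace e) = c (M.rightFace f) := by
    intro w
    induction w with
    | nil =>
      intro u v h e f he hf
      exact hvert e f (he.trans (Eq.trans h hf.symm))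
    | cons x w ih =>
      obtain ⟨g, b⟩ := x
      intro u v h e f he hf
      cases b with
      | true =>
        rw [hvert e g (he.trans h.1.symm), ← hblue g]
        exact ih _ _ h.2 _ f (M.src_blue g) hf
      | false =>
        rw [hvert e (M.blue g) (he.trans (h.1.symm.trans (M.src_blue g).symm)), hblue]
        exact ih _ _ h.2 _ f rfl hf
  have hconst : ∀ e f, c (M.rightFace e) = c (M.rightFace f) := fun e f =>
    let ⟨w, hw⟩ := hM.connected (M.src e) (M.src f)
    hwalk w _ _ hw e f rfl rfl
  have hall : ∀ F G, c F = c G := by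
    have : ∀ F, ∃ e, c F = c (M.rightFace e) := by
      rintro (F | F) <;> obtain ⟨e, rfl⟩ := Quotient.exists_rep F
      exacts [⟨e, rfl⟩, ⟨e, hlr e⟩]
    intro F G
    obtain ⟨e, he⟩ := this F
    obtain ⟨f, hf⟩ := this G
    rw [he, hf, hconst e f]
  funext F
  by_contra hF
  have := hM.infinite_face
  exact Set.infinite_univ (hc.subset fun G _ => by rwa [Function.mem_support, hall G F])

/-! ### Simple closed walks -/

variable (M) in
/-- The starting point of a step of a walk. -/
def stepSrc (x : E × Bool) : V := if x.2 then M.src x.1 else M.tgt x.1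

theorem IsWalk.src_tgt_mem {u v : V} {w : List (E × Bool)} (h : M.IsWalk u v w) {f : E}
    (hf : f ∈ w.map Prod.fst) :
    M.src f ∈ w.map M.stepSrc ++ [v] ∧ M.tgt f ∈ w.map M.stepSrc ++ [v] := by
  induction w generalizing u with
  | nil => simp at hf
  | cons x w ih =>
    have hu : ∀ {u'}, M.IsWalk u' v w → u' ∈ w.map M.stepSrc ++ [v] := by
      intro u' h
      cases w with
      | nil => exact List.mem_singleton.2 h
      | cons y w =>
        obtain ⟨g, b⟩ := y
        cases b <;> simp [stepSrc, h.1]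
    obtain ⟨e, b⟩ := x
    simp only [List.map_cons, List.cons_append] at hf ⊢
    rcases List.mem_cons.1 hf with rfl | hf
    · cases b
      · exact ⟨List.mem_cons_of_mem _ (hu h.2), List.mem_cons.2 (Or.inl rfl)⟩
      · exact ⟨List.mem_cons.2 (Or.inl rfl), List.mem_cons_of_mem _ (hu h.2)⟩
    · have : ∃ u', M.IsWalk u' v w := by
        cases b
        exacts [⟨_, h.2⟩, ⟨_, h.2⟩]
      obtain ⟨u', h'⟩ := this
      exact ⟨List.mem_cons_of_mem _ (ih h' hf).1, List.mem_cons_of_mem _ (ih h' hf).2⟩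

/-- Conservation of flow at a vertex. -/
theorem IsPlanar.sum_jump (hM : M.IsPlanar) (c : M.Face → ℤ) (v : V) :
    ∃ s t : Finset E, (∀ e, e ∈ s ↔ M.tgt e = v) ∧ (∀ e, e ∈ t ↔ M.src e = v) ∧
      ∑ e ∈ s, M.jump c e = ∑ e ∈ t, M.jump c e := by
  have hs : ∀ e, e ∈ (hM.finite_in v).toFinset ↔ M.tgt e = v := by simp
  set s := (hM.finite_in v).toFinset
  -- Incoming edges are matched with outgoing ones by `red`, which keeps the left face, and by
  -- `blue`, which keeps the right face.
  have ht : ∀ (b : Bool) e, e ∈ s.map (M.next b).toEmbedding ↔ M.src e = v := by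
    intro b e
    obtain ⟨f, rfl⟩ := (M.next b).surjective e
    simp [src_next, hs]
  refine ⟨s, s.map (M.next true).toEmbedding, hs, ht true, ?_⟩
  have h : s.map (M.next true).toEmbedding = s.map (M.next false).toEmbedding := by
    ext e
    rw [ht, ht]
  simp only [jump, Finset.sum_sub_distrib]
  congr 1
  · rw [h, Finset.sum_map]
    exact Finset.sum_congr rfl fun e _ => congrArg c (face_next false e).symm
  · rw [Finset.sum_map]
    exact Finset.sum_congr rfl fun e _ => congrArg c (face_next true e).symm

/-- The walk leaves its first vertex by one edge and never returns, so no other edge there can carry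
flow. Conservation then empties this edge too, and the remaining walk is again simple. -/
theorem IsPlanar.jump_eq_zero_of_simple (hM : M.IsPlanar) {c : M.Face → ℤ} {u v : V}
    {w : List (E × Bool)} (hw : M.IsWalk u v w) (hn : (w.map M.stepSrc ++ [v]).Nodup)
    (hc : ∀ f, f ∉ w.map Prod.fst → M.jump c f = 0) (f : E) : M.jump c f = 0 := by
  induction w generalizing u with
  | nil => exact hc f (by simp)
  | cons x w ih =>
    obtain ⟨s, t, hs, ht, hst⟩ := hM.sum_jump c u
    obtain ⟨e, b⟩ := x
    have hu : M.stepSrc (e, b) = u := by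
      cases b
      exacts [hw.1, hw.1]
    obtain ⟨u', hw'⟩ : ∃ u', M.IsWalk u' v w := by
      cases b
      exacts [⟨_, hw.2⟩, ⟨_, hw.2⟩]
    simp only [List.map_cons, List.cons_append, List.nodup_cons, hu] at hn
    have hne : ∀ g, g ≠ e → (M.src g = u ∨ M.tgt g = u) → M.jump c g = 0 := by
      intro g hg hgu
      refine hc g fun hmem => ?_
      rcases List.mem_cons.1 hmem with rfl | hmem
      · exact hg rfl
      · have := hw'.src_tgt_mem hmem
        rcases hgu with rfl | rfl
        exacts [hn.1 this.1, hn.1 this.2]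
    have hw2 := hw.src_tgt_mem (f := e) (by simp)
    have he : M.jump c e = 0 := by
      -- A loop would cancel from the conservation law; simplicity excludes it.
      have hloop : ¬ (M.src e = u ∧ M.tgt e = u) := by
        rintro ⟨h1, h2⟩
        have : u ∈ w.map M.stepSrc ++ [v] := by
          cases w with
          | nil =>
            cases b
            · exact List.mem_singleton.2 (h1.symm.trans hw.2)
            · exact List.mem_singleton.2 (h2.symm.trans hw.2)
          | cons y w =>
            obtain ⟨g, b'⟩ := y
            cases b <;> cases b' <;> have h := hw.2.1 <;> simp [stepSrc, h, h1, h2]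
        exact hn.1 this
      cases b
      · have h1 : M.tgt e = u := hw.1
        rw [Finset.sum_eq_single_of_mem e ((hs e).2 h1) fun g hg hge => hne g hge (Or.inr ((hs g).1 hg)),
          Finset.sum_eq_zero fun g hg => hne g (fun h => hloop ⟨(ht e).1 (h ▸ hg), h1⟩)
            (Or.inl ((ht g).1 hg))] at hst
        exact hst
      · have h1 : M.src e = u := hw.1
        rw [Finset.sum_eq_single_of_mem (s := t) e ((ht e).2 h1)
            fun g hg hge => hne g hge (Or.inl ((ht g).1 hg)),
          Finset.sum_eq_zero fun g hg => hne g (fun h => hloop ⟨h1, (hs e).1 (h ▸ hg)⟩)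
            (Or.inr ((hs g).1 hg))] at hst
        exact hst.symm
    refine ih hw' hn.2 fun g hg => ?_
    by_cases hge : g = e
    · rw [hge, he]
    · exact hc g (by simpa [hge] using hg)

/-! ### Enclosed faces -/

/-- The faces that can be reached without crossing `A`. -/
def Joined (M : BicoloredQuiver V E) (A : Set E) : M.Face → M.Face → Prop :=
  Relation.ReflTransGen (M.Crossing A)

theorem Crossing.symm {A : Set E} {F G : M.Face} (h : M.Crossing A F G) : M.Crossing A G F := by
  obtain ⟨e, he, h | h⟩ := h
  exacts [⟨e, he, Or.inr ⟨h.2, h.1⟩⟩, ⟨e, he, Or.inl ⟨h.2, h.1⟩⟩]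

theorem Joined.symm {A : Set E} {F G : M.Face} (h : M.Joined A F G) : M.Joined A G F := by
  induction h with
  | refl => exact .refl
  | tail _ h ih => exact .head h.symm ih

theorem joined_left_right {A : Set E} {e : E} (he : e ∉ A) :
    M.Joined A (M.leftFace e) (M.rightFace e) :=
  .single ⟨e, he, Or.inl ⟨rfl, rfl⟩⟩

theorem joined_face {A : Set E} {e : E} (he : e ∉ A) (b : Bool) :
    M.Joined A (M.face b e) (M.face (!b) e) := by
  cases b
  exacts [joined_left_right he, (joined_left_right he).symm]

theorem mem_enclosed_of_joined {A : Set E} {F G : M.Face} (h : M.Joined A F G)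
    (hF : F ∈ M.enclosed A) : G ∈ M.enclosed A :=
  Set.Finite.subset hF fun _ hH => h.trans hH

theorem eq_of_joined {A : Set E} {c : M.Face → ℤ} (hc : ∀ f ∉ A, M.jump c f = 0) {F G : M.Face}
    (h : M.Joined A F G) : c F = c G := by
  induction h with
  | refl => rfl
  | tail _ h ih =>
    obtain ⟨e, he, h | h⟩ := h <;> have := sub_eq_zero.1 (hc e he) <;> rw [ih, h.1, h.2, this]

variable (M) in
/-- `A` has an inner and an outer side: exactly one of the two faces of any edge in `A` is enclosed
by `A`. -/
def TwoSided (A : Set E) : Prop :=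
  (M.enclosed A).Finite ∧
    ∀ f ∈ A, (M.leftFace f ∈ M.enclosed A ↔ M.rightFace f ∉ M.enclosed A)

open Classical in
/-- The Jordan curve theorem for simple closed walks. -/
theorem IsPlanar.twoSided_of_simple (hM : M.IsPlanar) {v : V} {w : List (E × Bool)}
    (hw : M.IsWalk v v w) (hn : (w.map M.stepSrc).Nodup) (he : (w.map Prod.fst).Nodup)
    {A : Set E} (hA : ∀ f, f ∈ A ↔ f ∈ w.map Prod.fst) (hne : w ≠ []) : M.TwoSided A := by
  obtain ⟨c, hc, hjump⟩ := hM.exists_winding hw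
  have hoff : ∀ f ∉ A, M.jump c f = 0 := fun f hf => by
    rw [hjump, traversals_eq_zero (fun h => hf ((hA f).2 h))]
  have hon : ∀ f ∈ A, M.jump c f = 1 ∨ M.jump c f = -1 := by
    intro f hf
    obtain ⟨⟨f, b⟩, hx, rfl⟩ := List.mem_map.1 ((hA f).1 hf)
    rw [hjump, traversals_of_nodup he hx]
    cases b <;> simp
  have hencl : ∀ F, c F ≠ 0 → F ∈ M.enclosed A := fun F hF =>
    hc.subset fun G hG => by
      rw [Function.mem_support, ← eq_of_joined hoff hG]
      exact hF
  have hunit : ∀ F ∈ M.enclosed A, c F = 1 ∨ c F = -1 := by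
    intro F hF
    let K : M.Face → ℤ := fun G => if M.Joined A F G then 1 else 0
    have hK : ∀ f ∉ A, M.jump K f = 0 := by
      intro f hf
      have := joined_left_right (M := M) hf
      have : M.Joined A F (M.leftFace f) ↔ M.Joined A F (M.rightFace f) :=
        ⟨fun h => h.trans this, fun h => h.trans this.symm⟩
      simp [jump, K, this]
    have hKfin : K.support.Finite := hF.subset fun G hG => by
      by_contra h
      exact hG (if_neg h)
    obtain ⟨⟨e, b⟩, w', rfl⟩ := List.exists_cons_of_ne_nil hne
    have hv : M.stepSrc (e, b) = v := by
      cases b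
      exacts [hw.1, hw.1]
    obtain ⟨u, hw'⟩ : ∃ u, M.IsWalk u v w' := by
      cases b
      exacts [⟨_, hw.2⟩, ⟨_, hw.2⟩]
    have heA : e ∈ A := (hA e).2 (by simp)
    -- `K` is the indicator of the component of `F`. As `c` jumps by `±1` at `e`, this `m` makes `K
    -- - m c` jump-free at `e`; its jumps then live on a simple open walk, so it vanishes.
    -- Evaluation at `F` shows that `c F` is a unit.
    let m := M.jump K e * M.jump c e
    let d : M.Face → ℤ := fun G => K G - m * c G
    have hd : ∀ f, M.jump d f = M.jump K f - m * M.jump c f := fun f => by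
      simp only [jump, d]
      ring
    have hd0 : d = 0 := by
      refine hM.eq_zero_of_jump ?_ (hM.jump_eq_zero_of_simple hw' ?_ fun f hf => ?_)
      · refine (hKfin.union hc).subset fun G hG => ?_
        by_contra h
        simp only [Set.mem_union, Function.mem_support, not_or, not_not] at h
        exact hG (by simp [d, h])
      · rw [List.map_cons, hv] at hn
        exact (List.nodup_append_comm (l₁ := [v])).1 hn
      · rw [hd]
        by_cases hfe : f = e
        · subst hfe
          rcases hon f heA with h | h <;> simp [m, h]
        · have : f ∉ A := fun h => by
            rcases List.mem_cons.1 ((hA f).1 h) with h | h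
            exacts [hfe h, hf h]
          rw [hK f this, hoff f this]
          simp
    have := congrFun hd0 F
    have hKF : K F = 1 := if_pos .refl
    have : c F * m = 1 := by
      simp only [d, hKF, Pi.zero_apply] at this
      linarith
    exact Int.eq_one_or_neg_one_of_mul_eq_one this
  refine ⟨hc.subset fun F hF => ?_, fun f hf => ⟨fun hl hr => ?_, fun hr => ?_⟩⟩
  · have := hunit F hF
    rw [Function.mem_support]
    omega
  -- Two values `±1` differ by an even number, but the jump is `±1`.
  · have h1 := hunit _ hl
    have h2 := hunit _ hr
    have h3 := hon f hf
    simp only [jump] at h3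
    omega
  · refine hencl _ fun hl => ?_
    have h0 : c (M.rightFace f) = 0 := by
      by_contra h
      exact hr (hencl _ h)
    have h3 := hon f hf
    simp only [jump] at h3
    omega

/-! ### Comparing enclosed regions -/

/-- A chain of faces that starts outside the region enclosed by `A` and avoids crossing `A` stays
outside, so it never crosses an edge of `B`: an unbounded component for `A` lies in one for `B`. -/
theorem enclosed_subset {A B : Set E}
    (h : ∀ f ∈ B, f ∈ A ∨ M.leftFace f ∈ M.enclosed A ∨ M.rightFace f ∈ M.enclosed A) :
    M.enclosed B ⊆ M.enclosed A := by
  intro F hF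
  by_contra hFA
  refine hFA (hF.subset fun G hG => ?_)
  have : M.Joined A F G := hG
  induction this with
  | refl => exact .refl
  | @tail G H hFG hGH ih =>
    refine (ih hFG).tail ?_
    have hG : G ∉ M.enclosed A := fun h => hFA (mem_enclosed_of_joined (Joined.symm hFG) h)
    have hH : H ∉ M.enclosed A := fun h => hG (mem_enclosed_of_joined (.single hGH.symm) h)
    obtain ⟨e, he, h'⟩ := hGH
    refine ⟨e, fun heB => ?_, h'⟩
    rcases h e heB with h | h
    · exact he h
    · rcases h' with ⟨rfl, rfl⟩ | ⟨rfl, rfl⟩ <;> tauto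

theorem enclosed_mono {A B : Set E} (h : A ⊆ B) : M.enclosed A ⊆ M.enclosed B :=
  fun F hF => hF.subset fun _ hG => Relation.ReflTransGen.mono
    (fun _ _ ⟨e, he, h'⟩ => ⟨e, fun heA => he (h heA), h'⟩) F _ hG

theorem face_mem_enclosed {A : Set E} {e : E} (he : e ∉ A) {b : Bool}
    (h : M.face b e ∈ M.enclosed A) (b' : Bool) : M.face b' e ∈ M.enclosed A := by
  by_cases hb : b' = b
  · rwa [hb]
  · rw [Bool.eq_not_of_ne hb]
    exact mem_enclosed_of_joined (joined_face he b) h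

theorem TwoSided.face_iff {A : Set E} (hA : M.TwoSided A) {f : E} (hf : f ∈ A) (b : Bool) :
    M.face b f ∈ M.enclosed A ↔ M.face (!b) f ∉ M.enclosed A := by
  have := hA.2 f hf
  cases b
  · exact this
  · exact (not_iff_comm.1 this.symm).symm

/-- Replacing a broken wheel by its mirror image or by its interface makes the enclosed region
smaller, if the interface lies inside. -/
theorem TwoSided.enclosed_ssubset (hM : M.IsPlanar) {A B : Set E} (hA : M.TwoSided A) {b : Bool}
    {h : E} (hW : ∀ f ∈ M.wheel b h, f ∈ A) (hh : h ∉ A)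
    (hface : ∃ b', M.face b' h ∈ M.enclosed A)
    (hB : ∀ f ∈ B, f = h ∨ f ∈ M.wheel (!b) h ∨ (f ∈ A ∧ f ∉ M.wheel b h)) :
    M.enclosed B ⊂ M.enclosed A := by
  obtain ⟨b', hb'⟩ := hface
  have hall := face_mem_enclosed hh hb'
  have hsub : M.enclosed B ⊆ M.enclosed A := by
    refine enclosed_subset fun f hf => ?_
    rcases hB f hf with rfl | h' | h'
    · exact Or.inr (Or.inl (hall false))
    · exact Or.inr (leftFace_eq_or (P := (· ∈ M.enclosed A)) (b := !b)
        ((hM.mem_wheel.1 h').1 ▸ hall (!b)))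
    · exact Or.inl h'.1
  refine ⟨hsub, fun hsub' => ?_⟩
  -- Strictness: the first edge `w` of the wheel has an inner and an outer side for `A` but is
  -- missing from `B`, so its inner face is no longer enclosed.
  have hw := hM.next_mem_wheel b h
  set w := M.next b h
  have hwb : M.face b w ∈ M.enclosed A := (hM.mem_wheel.1 hw).1 ▸ hall b
  have hwnb := (hA.face_iff (hW w hw) b).1 hwb
  have hwB : w ∉ B := by
    intro hwB
    rcases hB w hwB with h' | h' | h'
    · exact (hM.mem_wheel.1 hw).2 h'
    · exact hwnb ((hM.mem_wheel.1 h').1 ▸ hall (!b))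
    · exact h'.2 hw
  exact hwnb (hsub (mem_enclosed_of_joined (joined_face hwB b) (hsub' hwb)))

/-- The two faces of an edge are enclosed by the two broken wheels with this interface. -/
theorem IsPlanar.eq_or_eq_of_joined (hM : M.IsPlanar) {A : Set E} {h : E}
    (hA : ∀ b, ∀ f ∈ M.wheel b h, f ∈ A) {b : Bool} {F : M.Face} (hF : M.Joined A (M.face b h) F) :
    F = M.face b h ∨ F = M.face (!b) h := by
  -- All the sides of the two faces except `h` belong to `A`, so the only way out of either face
  -- leads through `h` to the other.
  have key : ∀ c f, M.face c f = M.face c h → f ∉ A → f = h := by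
    intro c f hc hf
    by_contra hne
    exact hf (hA c f (hM.mem_wheel.2 ⟨hc, hne⟩))
  induction hF with
  | refl => exact Or.inl rfl
  | tail _ hGH ih =>
    obtain ⟨e, he, h'⟩ := hGH
    have hcol : ∀ c, (∃ c', M.face c e = M.face c' h) → e = h := by
      rintro c ⟨c', hc⟩
      by_cases hcc : c' = c
      · exact key c e (hcc ▸ hc) he
      · rw [Bool.eq_not_of_ne hcc] at hc
        exact absurd hc (face_ne _ _ _)
    have heh : e = h := by
      rcases h' with ⟨rfl, rfl⟩ | ⟨rfl, rfl⟩
      · exact hcol false (ih.elim (fun h => ⟨_, h⟩) fun h => ⟨_, h⟩)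
      · exact hcol true (ih.elim (fun h => ⟨_, h⟩) fun h => ⟨_, h⟩)
    subst heh
    have : ∀ c, M.face c e = M.face b e ∨ M.face c e = M.face (!b) e := by
      intro c
      cases b <;> cases c <;> simp
    rcases h' with ⟨-, rfl⟩ | ⟨-, rfl⟩
    exacts [this true, this false]

theorem IsPlanar.face_mem_enclosed_of_wheels (hM : M.IsPlanar) {A : Set E} {h : E}
    (hA : ∀ b, ∀ f ∈ M.wheel b h, f ∈ A) (b : Bool) : M.face b h ∈ M.enclosed A :=
  (Set.toFinite {M.face b h, M.face (!b) h}).subset fun _ hF => hM.eq_or_eq_of_joined hA hF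

/-! ### Bigons -/

/-- Two different paths from `u` to `v` which together form a simple closed curve. -/
structure Bigon (M : BicoloredQuiver V E) (u v : V) (p p' : List E) : Prop where
  left : M.IsPath u v p
  right : M.IsPath u v p'
  nodup : (p.map M.src ++ p'.map M.tgt).Nodup
  ne : p ≠ p'

theorem isWalk_append {u v : V} {w w' : List (E × Bool)} :
    M.IsWalk u v (w ++ w') ↔ ∃ x, M.IsWalk u x w ∧ M.IsWalk x v w' := by
  induction w generalizing u with
  | nil => simp [IsWalk]
  | cons x w ih =>
    obtain ⟨e, b⟩ := x
    cases b <;> simp [IsWalk, ih, and_assoc]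

theorem IsPath.isWalk {u v : V} {p : List E} (h : M.IsPath u v p) :
    M.IsWalk u v (p.map (fun f => (f, true))) := by
  induction p generalizing u with
  | nil => exact h
  | cons e p ih => exact ⟨h.1, ih h.2⟩

theorem IsPath.isWalk_reverse {u v : V} {p : List E} (h : M.IsPath u v p) :
    M.IsWalk v u (p.reverse.map (fun f => (f, false))) := by
  induction p generalizing u with
  | nil => exact Eq.symm h
  | cons e p ih =>
    rw [List.reverse_cons, List.map_append]
    exact isWalk_append.2 ⟨_, ih h.2, rfl, h.1⟩

namespace Bigon

variable {u v : V} {p p' : List E}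

/-- Since the sources along `p` and the targets along `p'` are all distinct, a common edge would be
both first and last on either path, and the paths would coincide. -/
theorem disjoint (h : M.Bigon u v p p') {f : E} (hf : f ∈ p) (hf' : f ∈ p') : False := by
  obtain ⟨hs, ht, hd⟩ := List.nodup_append.1 h.nodup
  replace hd : ∀ x, x ∈ p.map M.src → x ∈ p'.map M.tgt → False := fun x h1 h2 => hd x h1 x h2 rfl
  obtain ⟨a, c, rfl⟩ := List.append_of_mem hf
  obtain ⟨a', c', rfl⟩ := List.append_of_mem hf'
  obtain ⟨x, hx, hxf, hxc⟩ := isPath_append.1 h.left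
  obtain ⟨x', hx', hxf', hxc'⟩ := isPath_append.1 h.right
  have hc : c = [] := by
    cases c with
    | nil => rfl
    | cons g c => exact (hd (M.tgt f) (by simp [hxc.1]) (by simp)).elim
  have ha' : a' = [] := by
    rcases List.eq_nil_or_concat a' with rfl | ⟨d, g, rfl⟩
    · rfl
    · have := hx'.tgt_of_getLast? (e := g) (by simp)
      exact (hd (M.src f) (by simp) (by simp [this, hxf'])).elim
  have ha : a = [] := by
    cases a with
    | nil => rfl
    | cons g a =>
      have h1 : M.src g = M.src f := by
        rw [hx.1, hxf', ← (show u = x' by rw [ha'] at hx'; exact hx')]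
      simp [h1] at hs
  have hc' : c' = [] := by
    rcases List.eq_nil_or_concat c' with rfl | ⟨d, g, rfl⟩
    · rfl
    · have h1 := hxc'.tgt_of_getLast? (e := g) (by simp)
      have h2 : M.tgt f = v := by rw [hc] at hxc; exact hxc
      rw [← h2] at h1
      simp [List.nodup_append, h1] at ht
  exact h.ne (by rw [ha, hc, ha', hc'])

theorem twoSided (hM : M.IsPlanar) (h : M.Bigon u v p p') :
    M.TwoSided {e | e ∈ p ∨ e ∈ p'} := by
  obtain ⟨hs, ht, hd⟩ := List.nodup_append.1 h.nodup
  refine hM.twoSided_of_simple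
    (w := p.map (fun f => (f, true)) ++ p'.reverse.map (fun f => (f, false)))
    (isWalk_append.2 ⟨v, h.left.isWalk, h.right.isWalk_reverse⟩) ?_ ?_ (fun f => ?_) ?_
  · have := (((p'.map M.tgt).reverse_perm).append_left (p.map M.src)).nodup_iff.2 h.nodup
    simpa [Function.comp_def, stepSrc] using this
  · simp only [List.map_append, List.map_map, Function.comp_def, List.map_id']
    refine List.nodup_append.2 ⟨hs.of_map, List.nodup_reverse.2 ht.of_map, ?_⟩
    rintro f hf _ hf' rfl
    exact h.disjoint hf (List.mem_reverse.1 hf')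
  · simp
  · intro h'
    rw [List.append_eq_nil_iff, List.map_eq_nil_iff, List.map_eq_nil_iff,
      List.reverse_eq_nil_iff] at h'
    exact h.ne (h'.1.trans h'.2.symm)

end Bigon

/-! ### Wheels in paths -/

/-- Edges of `p` are determined by their sources, so `W` and `c` must agree edge by edge; `c` cannot
run out first because no edge of `W` starts at `v`. -/
theorem IsPath.prefix_of_subset {v x t : V} {p a c W : List E} (hp : (p.map M.src).Nodup)
    (hpa : p = a ++ c) (hc : M.IsPath x v c) (hW : M.IsPath x t W) (hWp : W ⊆ p)
    (hv : ∀ f ∈ W, M.src f ≠ v) : ∃ d, c = W ++ d := by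
  induction W generalizing x a c with
  | nil => exact ⟨c, rfl⟩
  | cons w W ih =>
    obtain ⟨hw, hW⟩ := hW
    cases c with
    | nil => exact absurd (hw.trans hc) (hv w (by simp))
    | cons g c =>
      obtain ⟨hg, hc⟩ := hc
      have hgw : g = w := List.inj_on_of_nodup_map hp (by simp [hpa])
        (hWp (by simp)) (hg.trans hw.symm)
      subst hgw
      obtain ⟨d, rfl⟩ := ih (a := a ++ [g]) (by simp [hpa]) hc hW
        (fun f hf => hWp (List.mem_cons_of_mem _ hf)) (fun f hf => hv f (List.mem_cons_of_mem _ hf))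
      exact ⟨d, rfl⟩

/-- A path that runs through all the edges of another path contains it as a segment. -/
theorem IsPath.exists_append {u v s t : V} {p W : List E} (hp : M.IsPath u v p)
    (hn : (p.map M.src ++ [v]).Nodup) (hW : M.IsPath s t W) (hWne : W ≠ []) (hWp : W ⊆ p) :
    ∃ a d, p = a ++ W ++ d ∧ M.IsPath u s a ∧ M.IsPath t v d := by
  obtain ⟨w, W, rfl⟩ := List.exists_cons_of_ne_nil hWne
  obtain ⟨hw, hW⟩ := hW
  obtain ⟨a, c, hac⟩ := List.append_of_mem (hWp (by simp : w ∈ w :: W))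
  obtain ⟨x, ha, hx, hc⟩ := isPath_append.1 (hac ▸ hp)
  obtain ⟨hn, -, hd⟩ := List.nodup_append.1 hn
  obtain ⟨d, rfl⟩ := IsPath.prefix_of_subset hn (a := a ++ [w]) (by simp [hac]) hc hW
    (fun f hf => hWp (List.mem_cons_of_mem _ hf)) fun f hf =>
      hd _ (List.mem_map_of_mem (hWp (List.mem_cons_of_mem _ hf))) _ (by simp)
  obtain ⟨y, hy, hd'⟩ := isPath_append.1 hc
  have : y = t := by
    have h1 := hy.cons_map_tgt
    have h2 := hW.cons_map_tgt
    rw [h1] at h2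
    simpa using h2
  exact ⟨a, d, by simp [hac], hw ▸ hx ▸ ha, this ▸ hd'⟩

/-- The swap of a segment. The last clause lets joining paths keep their last edge when that edge is
not swapped. -/
theorem IsPath.exists_replace {u v s t : V} {p W W' : List E} (hp : M.IsPath u v p)
    (hn : (p.map M.src ++ [v]).Nodup) (hW : M.IsPath s t W) (hW' : M.IsPath s t W') (hWne : W ≠ [])
    (hWp : W ⊆ p) : ∃ q, M.IsPath u v q ∧ (∀ f ∈ q, f ∈ W' ∨ (f ∈ p ∧ f ∉ W)) ∧
      ∀ e, p.getLast? = some e → e ∉ W → q.getLast? = some e := by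
  obtain ⟨a, d, rfl, ha, hd⟩ := hp.exists_append hn hW hWne hWp
  have hn := (List.nodup_append.1 hn).1.of_map
  refine ⟨a ++ W' ++ d, isPath_append.2 ⟨_, isPath_append.2 ⟨_, ha, hW'⟩, hd⟩, fun f hf => ?_,
    fun e he heW => ?_⟩
  · rcases List.mem_append.1 hf with hf | hf
    · rcases List.mem_append.1 hf with hf | hf
      · exact Or.inr ⟨by simp [hf], fun h' =>
          (List.nodup_append.1 (List.nodup_append.1 hn).1).2.2 f hf f h' rfl⟩
      · exact Or.inl hf
    · exact Or.inr ⟨by simp [hf], fun h' =>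
        (List.nodup_append.1 hn).2.2 f (by simp [h']) f hf rfl⟩
  · by_cases hd0 : d = []
    · subst hd0
      rw [List.append_nil, List.getLast?_append_of_ne_nil _ hWne] at he
      exact absurd (List.mem_of_getLast? he) heW
    · rwa [List.getLast?_append_of_ne_nil _ hd0] at he ⊢

/-- A simple closed path that runs through all the edges of another path is composed of that path
and a second one. -/
theorem IsPath.exists_complement {u s t : V} {p W : List E} (hp : M.IsPath u u p)
    (hn : (p.map M.src).Nodup) (hW : M.IsPath s t W) (hWn : W.Nodup) (hWne : W ≠ [])
    (hWp : W ⊆ p) : ∃ d, M.IsPath t s d ∧ ∀ f ∈ d, f ∈ p ∧ f ∉ W := by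
  obtain ⟨w, W, rfl⟩ := List.exists_cons_of_ne_nil hWne
  obtain ⟨hw, hW⟩ := hW
  obtain ⟨a, c, hac⟩ := List.append_of_mem (hWp (by simp : w ∈ w :: W))
  obtain ⟨x, ha, hx, hc⟩ := isPath_append.1 (hac ▸ hp)
  -- The cycle is rotated so that it begins with `w`.
  have hperm : p.Perm ([w] ++ (c ++ a)) := by
    rw [hac]
    exact List.perm_append_comm
  have hsub : W ⊆ p := fun f hf => hWp (List.mem_cons_of_mem _ hf)
  have hn' := (hperm.map M.src).nodup_iff.1 hn
  have hca : M.IsPath (M.tgt w) (M.src w) (c ++ a) := isPath_append.2 ⟨u, hc, hx ▸ ha⟩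
  obtain ⟨d, hd⟩ := IsPath.prefix_of_subset hn' rfl hca hW
    (fun f hf => hperm.subset (hsub hf)) fun f hf h => by
      have := List.inj_on_of_nodup_map hn (hsub hf) (hWp (by simp)) h
      exact (List.nodup_cons.1 hWn).1 (this ▸ hf)
  rw [hd] at hca hperm hn'
  obtain ⟨y, hy, hd'⟩ := isPath_append.1 hca
  have hyt : y = t := by
    have h1 := hy.cons_map_tgt
    have h2 := hW.cons_map_tgt
    rw [h1] at h2
    simpa using h2
  refine ⟨d, hyt ▸ hw ▸ hd', fun f hf => ⟨hperm.symm.subset (by simp [hf]), fun hfW => ?_⟩⟩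
  have hn2 := hn'.of_map
  rw [← List.append_assoc] at hn2
  exact (List.nodup_append.1 hn2).2.2 f (by simpa using hfW) f hf rfl

/-! ### Acyclic sets of edges -/

variable (M) in
/-- There are no oriented cycles in `T`. -/
def Acyclic (T : Set E) : Prop := ∀ u p, M.IsPath u u p → (∀ f ∈ p, f ∈ T) → p = []

theorem Acyclic.nodup_tgt {T : Set E} (hT : M.Acyclic T) {u v : V} {p : List E}
    (hp : M.IsPath u v p) (hpT : ∀ f ∈ p, f ∈ T) : (u :: p.map M.tgt).Nodup := by
  induction p generalizing u with
  | nil => simp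
  | cons e p ih =>
    refine List.nodup_cons.2 ⟨fun hu => ?_, ih hp.2 fun f hf => hpT f (by simp [hf])⟩
    obtain ⟨a, b, hab, ha, hua, -⟩ := hp.split_tgt hu
    exact ha (hT u a hua fun f hf => hpT f (by simp [hab, hf]))

theorem Acyclic.nodup_src {T : Set E} (hT : M.Acyclic T) {u v : V} {p : List E}
    (hp : M.IsPath u v p) (hpT : ∀ f ∈ p, f ∈ T) : (p.map M.src ++ [v]).Nodup :=
  hp.cons_map_tgt ▸ hT.nodup_tgt hp hpT

theorem IsPath.nodup_or_exists_cycle {u v : V} {p : List E} (hp : M.IsPath u v p) :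
    (p.map M.src).Nodup ∨
      ∃ x q, M.IsPath x x q ∧ q ≠ [] ∧ (q.map M.src).Nodup ∧ ∀ f ∈ q, f ∈ p := by
  induction p generalizing u with
  | nil => simp
  | cons e p ih =>
    rcases ih hp.2 with hn | ⟨x, q, hq, hne, hqn, hqp⟩
    · by_cases he : M.src e ∈ p.map M.src
      · right
        obtain ⟨a, b, rfl, hb, ha, hb'⟩ := hp.2.split_src he
        refine ⟨M.src e, e :: a, ⟨rfl, ha⟩, by simp, ?_, fun f hf => ?_⟩
        · rw [List.map_append] at hn
          obtain ⟨hn1, -, hd⟩ := List.nodup_append.1 hn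
          refine List.nodup_cons.2 ⟨fun hea => ?_, hn1⟩
          obtain ⟨g, b, rfl⟩ := List.exists_cons_of_ne_nil hb
          exact hd _ hea (M.src g) (by simp) hb'.1.symm
        · rcases List.mem_cons.1 hf with rfl | hf <;> simp_all
      · exact Or.inl (List.nodup_cons.2 ⟨he, hn⟩)
    · exact Or.inr ⟨x, q, hq, hne, hqn, fun f hf => by simp [hqp f hf]⟩

theorem IsPath.exists_simple_cycle {u : V} {p : List E} (hp : M.IsPath u u p) (hne : p ≠ []) :
    ∃ x q, M.IsPath x x q ∧ q ≠ [] ∧ (q.map M.src).Nodup ∧ ∀ f ∈ q, f ∈ p := by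
  rcases hp.nodup_or_exists_cycle with h | h
  · exact ⟨u, p, hp, hne, h, fun _ => id⟩
  · exact h

/-- Two paths from a common vertex to the two ends of an edge `x` contain two sides of a simple
closed curve that runs through `x`. -/
theorem Acyclic.exists_suffixes {T : Set E} (hT : M.Acyclic T) {j : V} {x : E} {p p' : List E}
    (hp : M.IsPath j (M.tgt x) p) (hp' : M.IsPath j (M.src x) p') (hpT : ∀ f ∈ p, f ∈ T)
    (hpT' : ∀ f ∈ p', f ∈ T) :
    ∃ k s s', s <:+ p ∧ s' <:+ p' ∧ M.IsPath k (M.tgt x) s ∧ M.IsPath k (M.src x) s' ∧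
      ((s' ++ [x]).map M.src ++ s.map M.tgt).Nodup := by
  induction hn : p.length using Nat.strong_induction_on generalizing j p p' with
  | _ n ih =>
  by_cases h : ((p' ++ [x]).map M.src ++ p.map M.tgt).Nodup
  · exact ⟨j, p, p', List.suffix_refl _, List.suffix_refl _, hp, hp', h⟩
  · have h1 := (List.nodup_cons.1 (hT.nodup_tgt hp hpT)).2
    have h2 := hT.nodup_src hp' hpT'
    obtain ⟨y, hy, hy'⟩ : ∃ y, y ∈ (p' ++ [x]).map M.src ∧ y ∈ p.map M.tgt := by
      by_contra hne
      push Not at hne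
      refine h (List.nodup_append.2 ⟨by simpa using h2, h1, ?_⟩)
      rintro a ha _ hb rfl
      exact hne a ha hb
    -- Both paths are cut at the common vertex `y`. The path `p` gets shorter, since `y` is the
    -- target of one of its edges.
    obtain ⟨a, b, rfl, ha, -, hb⟩ := hp.split_tgt hy'
    obtain ⟨a', b', rfl, hb'⟩ : ∃ a' b', p' = a' ++ b' ∧ M.IsPath y (M.src x) b' := by
      rw [List.map_append, List.mem_append] at hy
      rcases hy with hy | hy
      · obtain ⟨a', b', h1, -, -, h2⟩ := hp'.split_src hy
        exact ⟨a', b', h1, h2⟩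
      · exact ⟨p', [], by simp, (by simpa using hy : y = M.src x)⟩
    have := List.length_pos_iff.2 ha
    obtain ⟨k, s, s', hs, hs', hk⟩ := ih b.length (by simp at hn; omega) hb hb'
      (fun f hf => hpT f (by simp [hf])) (fun f hf => hpT' f (by simp [hf])) rfl
    exact ⟨k, s, s', hs.trans (List.suffix_append _ _), hs'.trans (List.suffix_append _ _), hk⟩

/-! ### Pre-shrubs -/

theorem Shrubby.exists_wheel (hQ : M.Shrubby) {u v : V} {p p' : List E} (hp : M.IsPath u v p)
    (hp' : M.IsPath u v p') (hne : p ≠ p') :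
    ∃ b h, (∃ b', M.face b' h ∈ M.region p p') ∧ (M.wheel b h ⊆ p ∨ M.wheel b h ⊆ p') := by
  obtain ⟨e, he, h⟩ := hQ u v p p' hp hp' hne
  have he' : ∃ b', M.face b' e ∈ M.region p p' := by
    rcases he with he | he
    exacts [⟨false, he⟩, ⟨true, he⟩]
  rcases h with h | h | h | h
  exacts [⟨true, e, he', Or.inl h⟩, ⟨false, e, he', Or.inl h⟩, ⟨true, e, he', Or.inr h⟩,
    ⟨false, e, he', Or.inr h⟩]

namespace Subgraph

variable {S : M.Subgraph}

theorem IsPreShrub.not_mem (hM : M.IsPlanar) (hS : S.IsPreShrub) {b : Bool} {e : E}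
    (h : ∀ f ∈ M.wheel b e, f ∈ S.edges) : e ∉ S.edges := by
  intro he
  refine hS.1 (M.face b e) fun f hf => ?_
  have hb : M.face b f = M.face b e := by
    rcases hf with hf | hf
    · cases b
      exacts [absurd hf.symm (leftFace_ne_rightFace _ _), hf]
    · cases b
      exacts [hf, absurd hf (leftFace_ne_rightFace _ _)]
  rcases List.mem_cons.1 (hM.mem_loop.2 hb) with rfl | hf
  exacts [he, h f hf]

theorem IsPreShrub.mirror (hS : S.IsPreShrub) {b : Bool} {e : E}
    (h : ∀ f ∈ M.wheel b e, f ∈ S.edges) : ∀ f ∈ M.wheel (!b) e, f ∈ S.edges := by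
  cases b
  exacts [(hS.2 e).2 h, (hS.2 e).1 h]

theorem IsPreShrub.wheels (hS : S.IsPreShrub) {b : Bool} {e : E}
    (h : ∀ f ∈ M.wheel b e, f ∈ S.edges) (c : Bool) : ∀ f ∈ M.wheel c e, f ∈ S.edges := by
  by_cases hc : c = b
  · exact hc ▸ h
  · exact Bool.eq_not_of_ne hc ▸ hS.mirror h

/-- A simple cycle bounds a bigon with the trivial path. The wheel given by shrubbiness lies on the
cycle, and its mirror image together with the rest of the cycle contains a simple cycle in `S` that
encloses fewer faces. -/
theorem IsPreShrub.acyclic (hM : M.IsPlanar) (hQ : M.Shrubby) (hS : S.IsPreShrub) :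
    M.Acyclic S.edges := by
  have key : ∀ (n : ℕ) (u : V) (p : List E), M.IsPath u u p → p ≠ [] → (p.map M.src).Nodup →
      (∀ f ∈ p, f ∈ S.edges) → (M.region p []).ncard = n → False := by
    intro n
    induction n using Nat.strong_induction_on with
    | _ n ih =>
    intro u p hp hne hn hpS hcard
    have hbig : M.Bigon u u p [] := ⟨hp, rfl, by simpa using hn, hne⟩
    have htwo := hbig.twoSided hM
    obtain ⟨b, h, hface, hW | hW⟩ := hQ.exists_wheel hp (p' := []) rfl hne
    · have hWS : ∀ f ∈ M.wheel b h, f ∈ S.edges := fun f hf => hpS f (hW hf)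
      have hh := hS.not_mem hM hWS
      obtain ⟨d, hd, hdp⟩ := hp.exists_complement hn (hM.isPath_wheel b h) (hM.wheel_nodup b h)
        (hM.wheel_ne_nil b h) hW
      obtain ⟨x, q, hq, hqne, hqn, hqsub⟩ := (isPath_append.2
        ⟨_, hM.isPath_wheel (!b) h, hd⟩).exists_simple_cycle (by simp [hM.wheel_ne_nil])
      have hlt := htwo.enclosed_ssubset hM (B := {f | f ∈ q ∨ f ∈ ([] : List E)}) (h := h) (b := b)
        (fun f hf => Or.inl (hW hf)) (fun h' => hh (hpS h (by simpa using h'))) hface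
        (fun f hf => by
          rcases List.mem_append.1 (hqsub f (by simpa using hf)) with h' | h'
          · exact Or.inr (Or.inl h')
          · exact Or.inr (Or.inr ⟨Or.inl (hdp f h').1, (hdp f h').2⟩))
      refine ih _ (hcard ▸ Set.ncard_lt_ncard hlt htwo.1) x q hq hqne hqn (fun f hf => ?_) rfl
      rcases List.mem_append.1 (hqsub f hf) with h' | h'
      exacts [hS.mirror hWS f h', hpS f (hdp f h').1]
    · exact hM.wheel_ne_nil b h (List.subset_nil.1 hW)
  intro u p hp hpS
  by_contra hne
  obtain ⟨x, q, hq, hqne, hqn, hqp⟩ := hp.exists_simple_cycle hne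
  exact key _ x q hq hqne hqn (fun f hf => hpS f (hqp f hf)) rfl

/-- An edge outside of a pre-shrub, both of whose ends can be reached from the same vertex of the
pre-shrub, is enclosed by the pre-shrub. -/
theorem IsPreShrub.face_mem_enclosed (hM : M.IsPlanar) (hQ : M.Shrubby) (hS : S.IsPreShrub)
    {x : E} (hx : x ∉ S.edges) {j : V} (ht : S.Reaches j (M.tgt x)) (hs : S.Reaches j (M.src x))
    (c : Bool) : M.face c x ∈ M.enclosed S.edges := by
  have hac := hS.acyclic hM hQ
  -- Induction on the number of faces between `s' ++ [x]` and `s`; the edge `x` may change along the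
  -- way.
  have key : ∀ (n : ℕ) (k : V) (s s' : List E) (x : E), x ∉ S.edges →
      M.Bigon k (M.tgt x) (s' ++ [x]) s → M.IsPath k (M.src x) s' → (∀ f ∈ s, f ∈ S.edges) →
      (∀ f ∈ s', f ∈ S.edges) → (M.region (s' ++ [x]) s).ncard = n →
      ∀ c, M.face c x ∈ M.enclosed S.edges := by
    intro n
    induction n using Nat.strong_induction_on with
    | _ n ih =>
    intro k s s' x hx hbig hs' hsS hsS' hcard
    have htwo := hbig.twoSided hM
    set A : Set E := {e | e ∈ s' ++ [x] ∨ e ∈ s}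
    have hAx : x ∈ A := Or.inl (by simp)
    have hAS : ∀ f ∈ A, f ≠ x → f ∈ S.edges := by
      rintro f (hf | hf) hfx
      · rcases List.mem_append.1 hf with hf | hf
        exacts [hsS' f hf, absurd (List.mem_singleton.1 hf) hfx]
      · exact hsS f hf
    obtain ⟨b, h, hface, hW⟩ := hQ.exists_wheel hbig.left hbig.right hbig.ne
    have hWA : ∀ f ∈ M.wheel b h, f ∈ A := fun f hf => hW.imp (fun h => h hf) (fun h => h hf)
    -- Here `y` will be `x`, after a swap, or the interface `h`, which shortcuts the wheel. The new
    -- paths are trimmed to a bigon around a smaller region.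
    have step : ∀ (y : E) (k : V) (p p' : List E), y ∉ S.edges → h ∉ A →
        M.IsPath k (M.tgt y) p → M.IsPath k (M.src y) p' →
        (∀ f ∈ p, f ∈ S.edges) → (∀ f ∈ p', f ∈ S.edges) →
        (∀ f, f ∈ p ∨ f ∈ p' ∨ f = y →
          f = h ∨ f ∈ M.wheel (!b) h ∨ (f ∈ A ∧ f ∉ M.wheel b h)) →
        ∀ c, M.face c y ∈ M.enclosed S.edges := by
      intro y k p p' hy hhA hp hp' hpS hpS' hB
      obtain ⟨l, t, t', ht, ht', hlt, hlt', hn⟩ := hac.exists_suffixes hp hp' hpS hpS'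
      have hlt := htwo.enclosed_ssubset hM (B := {e | e ∈ t' ++ [y] ∨ e ∈ t}) hWA hhA hface
        (fun f hf => hB f (by
          rcases hf with hf | hf
          · rcases List.mem_append.1 hf with hf | hf
            exacts [Or.inr (Or.inl (ht'.subset hf)), Or.inr (Or.inr (List.mem_singleton.1 hf))]
          · exact Or.inl (ht.subset hf)))
      refine ih _ (hcard ▸ Set.ncard_lt_ncard hlt htwo.1) l t t' y hy
        ⟨isPath_append.2 ⟨_, hlt', rfl, rfl⟩, ‹_›, hn, ?_⟩ hlt' (fun f hf => hpS f (ht.subset hf))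
        (fun f hf => hpS' f (ht'.subset hf)) rfl
      rintro rfl
      exact hy (hpS y (ht.subset (by simp)))
    have hpn : (s' ++ [x]).Nodup := (List.nodup_append.1 hbig.nodup).1.of_map
    by_cases hWS : ∀ f ∈ M.wheel b h, f ∈ S.edges
    · by_cases hhx : h = x
      · subst hhx
        exact hM.face_mem_enclosed_of_wheels (hS.wheels hWS)
      have hhA : h ∉ A := fun h' => hS.not_mem hM hWS (hAS h h' hhx)
      have hxW : x ∉ M.wheel b h := fun h' => hx (hWS x h')
      have hWmir := hS.mirror hWS
      rcases hW with hW | hW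
      · have hW' : M.wheel b h ⊆ s' := by
          intro f hf
          rcases List.mem_append.1 (hW hf) with h' | h'
          · exact h'
          · exact absurd (List.mem_singleton.1 h' ▸ hf) hxW
        obtain ⟨q, hq, hqsub, -⟩ := hs'.exists_replace (hac.nodup_src hs' hsS')
          (hM.isPath_wheel b h) (hM.isPath_wheel (!b) h) (hM.wheel_ne_nil b h) hW'
        refine step x k s q hx hhA hbig.right hq hsS (fun f hf => ?_) ?_
        · exact (hqsub f hf).elim (hWmir f) fun h' => hsS' f h'.1
        · rintro f (hf | hf | rfl)
          · exact Or.inr (Or.inr ⟨Or.inr hf, fun h' => hbig.disjoint (hW h') hf⟩)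
          · exact Or.inr ((hqsub f hf).imp id fun h' => ⟨Or.inl (by simp [h'.1]), h'.2⟩)
          · exact Or.inr (Or.inr ⟨hAx, hxW⟩)
      · obtain ⟨q, hq, hqsub, -⟩ := hbig.right.exists_replace (hac.nodup_src hbig.right hsS)
          (hM.isPath_wheel b h) (hM.isPath_wheel (!b) h) (hM.wheel_ne_nil b h) hW
        refine step x k q s' hx hhA hq hs' (fun f hf => ?_) hsS' ?_
        · exact (hqsub f hf).elim (hWmir f) fun h' => hsS f h'.1
        · rintro f (hf | hf | rfl)
          · exact Or.inr ((hqsub f hf).imp id fun h' => ⟨Or.inr h'.1, h'.2⟩)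
          · exact Or.inr (Or.inr ⟨Or.inl (by simp [hf]), fun h' =>
              hbig.disjoint (f := f) (by simp [hf]) (hW h')⟩)
          · exact Or.inr (Or.inr ⟨hAx, hxW⟩)
    -- The wheel runs through `x`, so `x` and `h` border the same face. If `h` is in `S`, then so is
    -- the wheel with interface `x` in this face; otherwise `h` is enclosed by induction, and `x`
    -- with it.
    · have hxW : x ∈ M.wheel b h := by
        by_contra h'
        exact hWS fun f hf => hAS f (hWA f hf) fun hfx => h' (hfx ▸ hf)
      have hfxh := (hM.mem_wheel.1 hxW).1
      have hhx : h ≠ x := fun h' => (hM.mem_wheel.1 hxW).2 h'.symm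
      replace hW : M.wheel b h ⊆ s' ++ [x] :=
        hW.resolve_right fun h' => hx (hsS x (h' hxW))
      by_cases hhS : h ∈ S.edges
      · refine hM.face_mem_enclosed_of_wheels (hS.wheels (b := b) fun f hf => ?_)
        rw [hM.mem_wheel, hfxh, ← hM.mem_loop, List.mem_cons] at hf
        rcases hf.1 with rfl | hf'
        exacts [hhS, hAS f (hWA f hf') hf.2]
      have hhA : h ∉ A := fun h' => hhS (hAS h h' hhx)
      have hconcl : (∀ c, M.face c h ∈ M.enclosed S.edges) →
          ∀ c, M.face c x ∈ M.enclosed S.edges := fun h' =>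
        BicoloredQuiver.face_mem_enclosed hx (hfxh ▸ h' b)
      -- If `s` is trivial, `s' ++ [x]` is a cycle whose part off the wheel joins the ends of `h`.
      -- Otherwise the wheel, containing the last edge `x`, is a final segment, and `h` starts where
      -- `x` ends.
      by_cases hs0 : s = []
      · subst hs0
        obtain rfl : k = M.tgt x := hbig.right
        obtain ⟨d, hd, hdp⟩ := hbig.left.exists_complement (by simpa using hbig.nodup)
          (hM.isPath_wheel b h) (hM.wheel_nodup b h) (hM.wheel_ne_nil b h) hW
        refine hconcl (step h (M.src h) d [] hhS hhA hd rfl (fun f hf => ?_) (by simp) ?_)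
        · exact hAS f (Or.inl (hdp f hf).1) fun h' => (hdp f hf).2 (h' ▸ hxW)
        · rintro f (hf | hf | hf)
          · exact Or.inr (Or.inr ⟨Or.inl (hdp f hf).1, (hdp f hf).2⟩)
          · simp at hf
          · exact Or.inl hf
      · have hwn : ((s' ++ [x]).map M.src ++ [M.tgt x]).Nodup := by
          obtain ⟨h1, -, h3⟩ := List.nodup_append.1 hbig.nodup
          refine List.nodup_append.2 ⟨h1, by simp, fun a ha y hy => ?_⟩
          rw [List.mem_singleton.1 hy]
          obtain ⟨t, g, rfl⟩ := (List.eq_nil_or_concat s).resolve_left hs0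
          have := hbig.right.tgt_of_getLast? (e := g) (by simp)
          exact h3 a ha _ (by simp [← this])
        obtain ⟨a, d, had, ha, hd⟩ := hbig.left.exists_append hwn (hM.isPath_wheel b h)
          (hM.wheel_ne_nil b h) hW
        have hn := had ▸ hpn
        have hd0 : d = [] := by
          by_contra hd0
          obtain ⟨t, g, rfl⟩ := (List.eq_nil_or_concat d).resolve_left hd0
          have : x = g := by
            have := congrArg List.getLast? had
            simpa using this
          exact (List.nodup_append.1 hn).2.2 x (by simp [hxW]) g (by simp) this
        subst hd0
        rw [List.append_nil] at hn had
        have hsrc : M.src h = M.tgt x := hd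
        have haA : ∀ f ∈ a, f ∈ A ∧ f ∉ M.wheel b h := fun f hf =>
          ⟨Or.inl (had ▸ List.mem_append_left _ hf), fun h' =>
            (List.nodup_append.1 hn).2.2 f hf f h' rfl⟩
        refine hconcl (step h k a s hhS hhA ha (hsrc ▸ hbig.right) (fun f hf => ?_) hsS ?_)
        · exact hAS f (haA f hf).1 fun h' => (haA f hf).2 (h' ▸ hxW)
        · rintro f (hf | hf | hf)
          · exact Or.inr (Or.inr (haA f hf))
          · exact Or.inr (Or.inr ⟨Or.inr hf, fun h' => hbig.disjoint (hW h') hf⟩)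
          · exact Or.inl hf
  obtain ⟨p, hp, hpS⟩ := ht
  obtain ⟨p', hp', hpS'⟩ := hs
  obtain ⟨k, s, s', hsp, hsp', hks, hks', hn⟩ := hac.exists_suffixes hp hp' hpS hpS'
  refine key _ k s s' x hx ⟨isPath_append.2 ⟨_, hks', rfl, rfl⟩, hks, hn, ?_⟩ hks'
    (fun f hf => hpS f (hsp.subset hf)) (fun f hf => hpS' f (hsp'.subset hf)) rfl c
  rintro rfl
  exact hx (hpS x (hsp.subset (by simp)))

end Subgraph

/-! ### Going around a vertex -/

theorem red_ccw (e : E) : M.red (M.ccw e) = M.blue e := by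
  simp [ccw]

theorem tgt_ccw_pow (e : E) (m : ℕ) : M.tgt ((M.ccw ^ m) e) = M.tgt e := by
  induction m with
  | zero => rfl
  | succ m ih =>
    rw [pow_succ', Equiv.Perm.mul_apply, ← M.src_red, red_ccw, M.src_blue, ih]

theorem ccw_pow_succ (e : E) (m : ℕ) : (M.ccw ^ (m + 1)) e = M.ccw ((M.ccw ^ m) e) := by
  rw [pow_succ', Equiv.Perm.mul_apply]

theorem ccw_pow_sub {e : E} {k m : ℕ} (h : k ≤ m) :
    (M.ccw ^ (m - k)) ((M.ccw ^ k) e) = (M.ccw ^ m) e := by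
  rw [← Equiv.Perm.mul_apply, ← pow_add, Nat.sub_add_cancel h]

theorem leftFace_ccw (e : E) : M.leftFace (M.ccw e) = M.leftFace (M.blue e) := by
  rw [← red_ccw]
  exact (face_next false (M.ccw e)).symm

theorem joined_ccw {A : Set E} {e : E} (h : M.blue e ∉ A) :
    M.Joined A (M.rightFace e) (M.leftFace (M.ccw e)) := by
  rw [leftFace_ccw, ← show M.rightFace (M.blue e) = M.rightFace e from face_next true e]
  exact (joined_left_right h).symm

theorem IsPlanar.exists_ccw_pow_self (hM : M.IsPlanar) (e : E) :
    ∃ N, 0 < N ∧ (M.ccw ^ N) e = e := by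
  have := (hM.finite_in (M.tgt e)).to_subtype
  obtain ⟨a, b, hab, h⟩ := Finite.exists_ne_map_eq_of_infinite
    (fun m : ℕ => (⟨(M.ccw ^ m) e, tgt_ccw_pow e m⟩ : {f | M.tgt f = M.tgt e}))
  replace h : (M.ccw ^ a) e = (M.ccw ^ b) e := congrArg Subtype.val h
  wlog hlt : a < b generalizing a b
  · exact this b a hab.symm h.symm (by omega)
  refine ⟨b - a, by omega, (M.ccw ^ a).injective ?_⟩
  rw [h, ← Equiv.Perm.mul_apply, ← pow_add, Nat.add_sub_cancel' hlt.le]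

theorem IsPlanar.exists_ccw_pow (hM : M.IsPlanar) {e f : E} (h : M.tgt e = M.tgt f) :
    ∃ m : ℕ, (M.ccw ^ m) e = f := by
  obtain ⟨N, hN, hNe⟩ := hM.exists_ccw_pow_self e
  obtain ⟨m, -, hm⟩ := exists_iterate_eq_of_sameCycle (π := M.ccw) (e := e)
    ⟨N, hN, by rwa [← Equiv.Perm.iterate_eq_pow] at hNe⟩ (M.single_vertex e f h)
  exact ⟨m, by rw [hm, Equiv.Perm.iterate_eq_pow]⟩

namespace Subgraph

variable {S : M.Subgraph} {i : V}

/-! ### The edges that end at the new vertex -/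

theorem src_mem_of_mem_add {f : E} (hf : f ∈ (S.add i).edges) : M.src f ∈ S.verts :=
  hf.elim (S.src_mem f) (fun h => h.1)

theorem src_ne_of_mem_add (hi : i ∉ S.verts) {f : E} (hf : f ∈ (S.add i).edges) : M.src f ≠ i :=
  fun h => hi (h ▸ src_mem_of_mem_add hf)

theorem mem_edgesTo_of_mem_add {f : E} (hf : f ∈ (S.add i).edges) (hfi : M.tgt f = i) :
    f ∈ S.edgesTo i :=
  ⟨src_mem_of_mem_add hf, hfi⟩

theorem mem_of_mem_add {f : E} (hf : f ∈ (S.add i).edges) (hfi : M.tgt f ≠ i) : f ∈ S.edges :=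
  hf.resolve_right fun h => hfi h.2

/-- A closed path through `i` would have to leave the sink `i`. -/
theorem acyclic_add (hi : i ∉ S.verts) (hac : M.Acyclic S.edges) :
    M.Acyclic (S.add i).edges := by
  intro u p hp hpT
  refine hac u p hp fun f hf => mem_of_mem_add (hpT f hf) fun hfi => ?_
  have hmem : i ∈ p.map M.src ++ [u] := hp.cons_map_tgt ▸
    List.mem_cons_of_mem _ (List.mem_map.2 ⟨f, hf, hfi⟩)
  have : i ∈ p.map M.src := by
    rcases List.mem_append.1 hmem with h | h
    · exact h
    · obtain ⟨g, q, rfl⟩ := List.exists_cons_of_ne_nil (List.ne_nil_of_mem hf)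
      exact List.mem_map.2 ⟨g, by simp, hp.1.trans (List.mem_singleton.1 h).symm⟩
  obtain ⟨g, hg, hgi⟩ := List.mem_map.1 this
  exact src_ne_of_mem_add hi (hpT g hg) hgi

theorem exists_consecutive (hM : M.IsPlanar) {e : E} (he : e ∈ S.edgesTo i) :
    ∃ e' n, S.Consecutive i e e' n := by
  classical
  obtain ⟨N, hN, hNe⟩ := hM.exists_ccw_pow_self e
  have hex : ∃ n, 0 < n ∧ (M.ccw ^ n) e ∈ S.edgesTo i := ⟨N, hN, hNe.symm ▸ he⟩
  refine ⟨_, Nat.find hex, he, (Nat.find_spec hex).2, (Nat.find_spec hex).1, rfl, ?_⟩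
  exact fun m hm hlt hmem => Nat.find_min hex hlt ⟨hm, hmem⟩

/-- Every edge that ends at `i` lies between two consecutive edges from `S` to `i`. -/
theorem exists_sector (hM : M.IsPlanar) (hk : (S.edgesTo i).Nonempty) {f : E} (hf : M.tgt f = i) :
    ∃ e e' n m, S.Consecutive i e e' n ∧ m < n ∧ (M.ccw ^ m) e = f := by
  classical
  have hex : ∃ m, ∃ e ∈ S.edgesTo i, (M.ccw ^ m) e = f := by
    obtain ⟨e, he⟩ := hk
    obtain ⟨m, hm⟩ := hM.exists_ccw_pow (e := e) (he.2.trans hf.symm)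
    exact ⟨m, e, he, hm⟩
  obtain ⟨e, he, hm⟩ := Nat.find_spec hex
  obtain ⟨e', n, hc⟩ := exists_consecutive hM he
  refine ⟨e, e', n, Nat.find hex, hc, ?_, hm⟩
  -- Otherwise `e'` is passed on the way from `e` to `f`, and fewer turns lead from `e'` to `f`.
  by_contra hlt
  refine Nat.find_min hex (m := Nat.find hex - n) ?_ ⟨e', hc.2.1, ?_⟩
  · have := hc.2.2.1
    omega
  · rw [← hc.2.2.2.1, ccw_pow_sub (by omega), hm]

/-- On turning counterclockwise from `e`, the edges leaving `i` are no obstacle by `h1`, and by `h2`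
and consecutiveness no incoming edge of `A` is met before the `n`-th. -/
theorem Consecutive.joined {e e' : E} {n : ℕ} (hc : S.Consecutive i e e' n) {A : Set E}
    (h1 : ∀ f ∈ A, M.src f ≠ i) (h2 : ∀ f ∈ A, M.tgt f = i → f ∈ S.edgesTo i) {m : ℕ}
    (hm : m < n) : M.Joined A (M.rightFace e) (M.rightFace ((M.ccw ^ m) e)) ∧
      M.Joined A (M.rightFace e) (M.leftFace ((M.ccw ^ (m + 1)) e)) := by
  have hstep : ∀ m, M.Joined A (M.rightFace ((M.ccw ^ m) e))
      (M.leftFace ((M.ccw ^ (m + 1)) e)) := by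
    intro m
    rw [ccw_pow_succ]
    exact joined_ccw fun h => h1 _ h (by rw [M.src_blue, tgt_ccw_pow, hc.1.2])
  have hr : M.Joined A (M.rightFace e) (M.rightFace ((M.ccw ^ m) e)) := by
    induction m with
    | zero => exact .refl
    | succ m ih =>
      refine ((ih (by omega)).trans (hstep m)).trans (joined_left_right fun h => ?_)
      exact hc.2.2.2.2 (m + 1) (by omega) hm (h2 _ h (by rw [tgt_ccw_pow, hc.1.2]))
  exact ⟨hr, hr.trans (hstep m)⟩

theorem Consecutive.joined_leftFace {e e' : E} {n : ℕ} (hc : S.Consecutive i e e' n) {A : Set E}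
    (h1 : ∀ f ∈ A, M.src f ≠ i) (h2 : ∀ f ∈ A, M.tgt f = i → f ∈ S.edgesTo i) :
    M.Joined A (M.rightFace e) (M.leftFace e') := by
  have hn := hc.2.2.1
  have := (hc.joined h1 h2 (m := n - 1) (by omega)).2
  rwa [Nat.sub_add_cancel hn, hc.2.2.2.1] at this

/-- Every face at `i` can be reached from one of the sectors between consecutive edges. -/
theorem exists_joined_rightFace (hM : M.IsPlanar) (hi : i ∉ S.verts)
    (hk : (S.edgesTo i).Nonempty) {f : E} (hf : M.src f = i ∨ M.tgt f = i) (b : Bool) :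
    ∃ e ∈ S.edgesTo i, M.Joined (S.add i).edges (M.rightFace e) (M.face b f) := by
  have hr : ∀ g, M.tgt g = i →
      ∃ e ∈ S.edgesTo i, M.Joined (S.add i).edges (M.rightFace e) (M.rightFace g) := by
    intro g hg
    obtain ⟨e, e', n, m, hc, hm, rfl⟩ := exists_sector hM hk hg
    exact ⟨e, hc.1, (hc.joined (fun f => src_ne_of_mem_add hi) (fun f => mem_edgesTo_of_mem_add)
      hm).1⟩
  have hl : ∀ g, M.tgt g = i →
      ∃ e ∈ S.edgesTo i, M.Joined (S.add i).edges (M.rightFace e) (M.leftFace g) := by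
    intro g hg
    obtain ⟨g', rfl⟩ := M.ccw.surjective g
    have hg' : M.tgt g' = i := (tgt_ccw_pow g' 1).symm.trans hg
    obtain ⟨e, he, hj⟩ := hr g' hg'
    exact ⟨e, he, hj.trans (joined_ccw fun h =>
      src_ne_of_mem_add hi h ((M.src_blue g').trans hg'))⟩
  rcases hf with hf | hf
  · obtain ⟨g, rfl⟩ := (M.next b).surjective f
    rw [face_next]
    rw [src_next] at hf
    cases b
    exacts [hl g hf, hr g hf]
  · cases b
    exacts [hl f hf, hr f hf]

/-- Not all the sectors at `i` are enclosed. -/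
theorem exists_rightFace_not_mem (hM : M.IsPlanar) (hint : S.interior ⊆ S.verts)
    (hi : i ∉ S.verts) (hk : (S.edgesTo i).Nonempty) :
    ∃ e ∈ S.edgesTo i, M.rightFace e ∉ M.enclosed (S.add i).edges := by
  by_contra! hall
  -- `U` collects the components of all the sectors and would be finite. Deleting the new edges does
  -- not lead out of `U`, as both sides of such an edge are faces at `i`. So `S` would enclose all
  -- faces at `i`, making `i` an interior vertex.
  let U : Set M.Face := ⋃ e ∈ S.edgesTo i, {G | M.Joined (S.add i).edges (M.rightFace e) G}
  have hU : U.Finite :=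
    ((hM.finite_in i).subset fun e he => he.2).biUnion fun e he => hall e he
  have hface : ∀ f, M.src f = i ∨ M.tgt f = i → ∀ b, M.face b f ∈ U := by
    intro f hf b
    obtain ⟨e, he, hj⟩ := exists_joined_rightFace hM hi hk hf b
    exact Set.mem_biUnion he hj
  have hencl : ∀ f, M.src f = i ∨ M.tgt f = i → ∀ b, M.face b f ∈ M.enclosed S.edges := by
    intro f hf b
    refine hU.subset fun G hG => ?_
    replace hG : M.Joined S.edges (M.face b f) G := hG
    induction hG with
    | refl => exact hface f hf b
    | tail _ hGH ih =>
      obtain ⟨g, hg, hgf⟩ := hGH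
      by_cases hgT : g ∈ (S.add i).edges
      · have hgi := (hgT.resolve_left hg).2
        rcases hgf with ⟨-, rfl⟩ | ⟨-, rfl⟩
        exacts [hface g (Or.inr hgi) true, hface g (Or.inr hgi) false]
      · obtain ⟨e, he, hj⟩ := Set.mem_iUnion₂.1 ih
        exact Set.mem_biUnion he (Relation.ReflTransGen.tail hj ⟨g, hgT, hgf⟩)
  exact hi (hint fun f hf => ⟨hencl f hf true, hencl f hf false⟩)

/-! ### Joining paths -/

section JoiningPaths

variable {e e' : E} {p p' : List E}

theorem JoiningPaths.symm (h : S.JoiningPaths i e e' p p') : S.JoiningPaths i e' e p' p := by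
  obtain ⟨j, h1, h2, h3, h4, h5, h6, h7, h8, h9⟩ := h
  exact ⟨j, h2, h1, h4, h3, h6, h5, h8, h7, fun v hv hv' => h9 v hv' hv⟩

theorem JoiningPaths.bigon (h : S.JoiningPaths i e e' p p') (hne : e ≠ e') :
    ∃ j, M.Bigon j i p p' := by
  obtain ⟨j, h1, h2, -, -, h5, h6, h7, h8, h9⟩ := h
  have h8' := h2.cons_map_tgt ▸ h8
  refine ⟨j, h1, h2, List.nodup_append.2 ⟨(List.nodup_append.1 h7).1, (List.nodup_cons.1 h8').2, ?_⟩,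
    ?_⟩
  · rintro v hv _ hv' rfl
    have hmem : v ∈ p'.map M.src ++ [i] := h2.cons_map_tgt ▸ List.mem_cons_of_mem _ hv'
    rcases List.mem_append.1 hmem with h | h
    · exact (List.nodup_cons.1 h8').1 (h9 v hv h ▸ hv')
    · exact (List.nodup_append.1 h7).2.2 v hv v h rfl
  · rintro rfl
    exact hne (Option.some_injective _ (h5.symm.trans h6))

theorem JoiningPaths.mem_add (h : S.JoiningPaths i e e' p p') {f : E} (hf : f ∈ p ∨ f ∈ p') :
    f ∈ (S.add i).edges := by
  obtain ⟨j, -, -, h3, h4, -⟩ := h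
  exact hf.elim (h3 f) (h4 f)

theorem JoiningPaths.mem_left (h : S.JoiningPaths i e e' p p') : e ∈ p := by
  obtain ⟨j, -, -, -, -, h5, -⟩ := h
  exact List.mem_of_getLast? h5

theorem JoiningPaths.eq_of_tgt_left (h : S.JoiningPaths i e e' p p') {f : E} (hf : f ∈ p)
    (hfi : M.tgt f = i) : f = e := by
  have he := h.mem_left
  obtain ⟨j, h1, -, -, -, h5, -, h7, -⟩ := h
  exact List.inj_on_of_nodup_map (List.nodup_cons.1 (h1.cons_map_tgt ▸ h7)).2 hf he
    (hfi.trans (h1.tgt_of_getLast? h5).symm)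

theorem JoiningPaths.eq_of_tgt (h : S.JoiningPaths i e e' p p') {f : E} (hf : f ∈ p ∨ f ∈ p')
    (hfi : M.tgt f = i) : f = e ∨ f = e' :=
  hf.imp (fun hf => h.eq_of_tgt_left hf hfi) fun hf => h.symm.eq_of_tgt_left hf hfi

theorem JoiningPaths.region_subset (h : S.JoiningPaths i e e' p p') :
    M.region p p' ⊆ M.enclosed (S.add i).edges :=
  enclosed_mono fun _ hf => h.mem_add hf

theorem region_comm (p p' : List E) : M.region p p' = M.region p' p := by
  simp only [region, or_comm]

/-- Any two paths to `i` with different last edges contain joining paths. -/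
theorem exists_joiningPaths (hac : M.Acyclic (S.add i).edges) {j : V} (hp : M.IsPath j i p)
    (hp' : M.IsPath j i p') (hpT : ∀ f ∈ p, f ∈ (S.add i).edges)
    (hpT' : ∀ f ∈ p', f ∈ (S.add i).edges) (he : p.getLast? = some e)
    (he' : p'.getLast? = some e') :
    ∃ s s', s <:+ p ∧ s' <:+ p' ∧ S.JoiningPaths i e e' s s' := by
  obtain ⟨q, rfl⟩ := List.getLast?_eq_some_iff.1 he'
  obtain ⟨x, hq, rfl, hi⟩ := isPath_append.1 hp'
  have hi : M.tgt e' = i := hi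
  subst hi
  obtain ⟨k, s, t, hs, ht, hks, hkt, hn⟩ := hac.exists_suffixes hp hq hpT
    fun f hf => hpT' f (by simp [hf])
  have hkt' : M.IsPath k (M.tgt e') (t ++ [e']) := isPath_append.2 ⟨_, hkt, rfl, rfl⟩
  have hte : t ++ [e'] <:+ q ++ [e'] := by
    obtain ⟨a, rfl⟩ := ht
    exact ⟨a, by simp⟩
  have hsne : s ≠ [] := by
    rintro rfl
    obtain rfl : k = M.tgt e' := hks
    simpa using hac _ _ hkt' fun f hf => hpT' f (hte.subset hf)
  have hsT := fun f hf => hpT f (hs.subset hf)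
  have htT := fun f hf => hpT' f (hte.subset hf)
  refine ⟨s, t ++ [e'], hs, hte, k, hks, hkt', hsT, htT, ?_, by simp, hac.nodup_src hks hsT,
    hac.nodup_src hkt' htT, fun v hv hv' => ?_⟩
  · obtain ⟨a, rfl⟩ := hs
    rwa [List.getLast?_append_of_ne_nil _ hsne] at he
  · have hmem : v ∈ k :: s.map M.tgt := hks.cons_map_tgt ▸ List.mem_append_left _ hv
    exact (List.mem_cons.1 hmem).resolve_right fun h =>
      (List.nodup_append.1 hn).2.2 v hv' v h rfl

/-- Regions between joining paths are finite, so one with the fewest faces is minimal for inclusion.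
-/
theorem JoiningPaths.exists_minimal (hM : M.IsPlanar) (hne : e ≠ e')
    (h : S.JoiningPaths i e e' p p') : ∃ q q', S.MinimalJoiningPaths i e e' q q' := by
  classical
  have hex : ∃ n, ∃ q q', S.JoiningPaths i e e' q q' ∧ (M.region q q').ncard = n :=
    ⟨_, p, p', h, rfl⟩
  obtain ⟨q, q', hq, hn⟩ := Nat.find_spec hex
  refine ⟨q, q', hq, fun t t' ht hsub => ?_⟩
  obtain ⟨j, hbig⟩ := hq.bigon hne
  have hle : (M.region q q').ncard ≤ (M.region t t').ncard := by
    rw [hn]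
    exact Nat.find_min' hex ⟨t, t', ht, rfl⟩
  exact (Set.eq_of_subset_of_ncard_le hsub hle (hbig.twoSided hM).1).ge

end JoiningPaths

/-- If the region between joining paths does not contain the sector that begins at `e`, then it
contains all the other ones. -/
theorem JoiningPaths.rightFace_mem (hM : M.IsPlanar) (hi : i ∉ S.verts) {e e' : E} {n : ℕ}
    (hc : S.Consecutive i e e' n) (hne : e ≠ e') {p p' : List E}
    (h : S.JoiningPaths i e e' p p') (hr : M.rightFace e ∉ M.region p p') {f : E}
    (hf : f ∈ S.edgesTo i) : f = e ∨ M.rightFace f ∈ M.region p p' := by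
  classical
  obtain ⟨j, hbig⟩ := h.bigon hne
  have htwo := hbig.twoSided hM
  have hsrc : ∀ g, (g ∈ p ∨ g ∈ p') → M.src g ≠ i := fun g hg => src_ne_of_mem_add hi (h.mem_add hg)
  have hl : M.leftFace e' ∉ M.region p p' := fun h' => hr (mem_enclosed_of_joined
    (hc.joined_leftFace hsrc fun g hg => mem_edgesTo_of_mem_add (h.mem_add hg)).symm h')
  have hr' : M.rightFace e' ∈ M.region p p' := by
    by_contra h'
    exact hl ((htwo.2 e' (Or.inr h.symm.mem_left)).2 h')
  have hex : ∃ m, (M.ccw ^ m) e' = f := hM.exists_ccw_pow (hc.2.1.2.trans hf.2.symm)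
  have hm := Nat.find_spec hex
  have hmin := fun k hk => Nat.find_min (m := k) hex hk
  set m := Nat.find hex
  by_cases hfe : f = e
  · exact Or.inl hfe
  right
  -- Only `e` and `e'` could stop the turn from `e'` to `f ≠ e`. Meeting `e'` again contradicts the
  -- minimality of `m`; so does meeting `e`, because the next edge from `S` after it is `e'`.
  have key : ∀ l ≤ m, M.rightFace ((M.ccw ^ l) e') ∈ M.region p p' := by
    intro l
    induction l with
    | zero => exact fun _ => hr'
    | succ l ih =>
      intro hlm
      have hleft : M.leftFace ((M.ccw ^ (l + 1)) e') ∈ M.region p p' := by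
        rw [ccw_pow_succ]
        refine mem_enclosed_of_joined (joined_ccw fun h' => hsrc _ h' ?_) (ih (by omega))
        rw [M.src_blue, tgt_ccw_pow, hc.2.1.2]
      refine mem_enclosed_of_joined (joined_left_right fun h' => ?_) hleft
      have hsub := ccw_pow_sub (M := M) (e := e') hlm
      rw [hm] at hsub
      rcases h.eq_of_tgt h' (by rw [tgt_ccw_pow, hc.2.1.2]) with h' | h'
      · rw [h'] at hsub
        have hlt : l + 1 ≠ m := by
          intro heq
          rw [← heq, Nat.sub_self] at hsub
          exact hfe hsub.symm
        have hn : n ≤ m - (l + 1) := by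
          by_contra hn
          exact hc.2.2.2.2 (m - (l + 1)) (by omega) (by omega) (hsub ▸ hf)
        refine hmin (m - (l + 1) - n) (by omega) ?_
        rw [← hc.2.2.2.1, ccw_pow_sub hn, hsub]
      · rw [h'] at hsub
        exact hmin _ (by omega) hsub
  exact hm ▸ key m le_rfl

theorem exists_reaches (hS : S.IsShrub) : ∃ r, ∀ v ∈ S.verts, S.Reaches r v := by
  obtain ⟨-, ⟨r, -, hr⟩, h, -⟩ := hS
  refine ⟨r, fun v hv => ?_⟩
  obtain ⟨r', hr', hv⟩ := h v hv
  exact hr r' hr' ▸ hv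

theorem Reaches.add {u v : V} (h : S.Reaches u v) : (S.add i).Reaches u v := by
  obtain ⟨p, hp, hpS⟩ := h
  exact ⟨p, hp, fun f hf => Or.inl (hpS f hf)⟩

theorem exists_minimalJoiningPaths (hM : M.IsPlanar) (hS : S.IsShrub)
    (hac : M.Acyclic (S.add i).edges) {e e' : E} (he : e ∈ S.edgesTo i) (he' : e' ∈ S.edgesTo i)
    (hne : e ≠ e') : ∃ p p', S.MinimalJoiningPaths i e e' p p' := by
  obtain ⟨r, hr⟩ := exists_reaches hS
  have hpath : ∀ f ∈ S.edgesTo i, ∃ p, M.IsPath r i p ∧ (∀ g ∈ p, g ∈ (S.add i).edges) ∧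
      p.getLast? = some f := by
    intro f hf
    obtain ⟨p, hp, hpS⟩ := hr _ hf.1
    refine ⟨p ++ [f], isPath_append.2 ⟨_, hp, rfl, hf.2⟩, fun g hg => ?_, by simp⟩
    rcases List.mem_append.1 hg with hg | hg
    exacts [Or.inl (hpS g hg), Or.inr (List.mem_singleton.1 hg ▸ hf)]
  obtain ⟨p, hp, hpT, hpe⟩ := hpath e he
  obtain ⟨p', hp', hpT', hpe'⟩ := hpath e' he'
  obtain ⟨s, s', -, -, h⟩ := exists_joiningPaths hac hp hp' hpT hpT' hpe hpe'
  exact h.exists_minimal hM hne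

/-- The last pair is the one whose sector is not enclosed by `S + i`. -/
theorem isLastPair_iff (hM : M.IsPlanar) (hQ : M.Shrubby) (hS : S.IsShrub) (hi : i ∉ S.verts)
    {e e' : E} {n : ℕ} (hc : S.Consecutive i e e' n) :
    S.IsLastPair i e e' ↔ M.rightFace e ∉ M.enclosed (S.add i).edges := by
  classical
  have hac := acyclic_add hi (hS.1.acyclic hM hQ)
  obtain ⟨f, hf, hfr⟩ := exists_rightFace_not_mem hM hS.2.2.2 hi ⟨e, hc.1⟩
  by_cases hne : e = e'
  · refine ⟨fun _ => ?_, fun _ => Or.inl hne⟩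
    -- When `e = e'`, a full turn meets no other edge from `S`, so `f = e`.
    have hex : ∃ m, (M.ccw ^ m) e = f := hM.exists_ccw_pow (hc.1.2.trans hf.2.symm)
    have hm := Nat.find_spec hex
    have hmin := fun k hk => Nat.find_min (m := k) hex hk
    set m := Nat.find hex
    have hm0 : m = 0 := by
      by_contra hm0
      have hn : n ≤ m := by
        by_contra hn
        exact hc.2.2.2.2 m (by omega) (by omega) (hm ▸ hf)
      have := hc.2.2.1
      refine hmin (m - n) (by omega) ?_
      rw [← hm, ← ccw_pow_sub hn, hc.2.2.2.1, hne]
    rw [hm0] at hm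
    rwa [show e = f from hm]
  · constructor
    · rintro (h | ⟨p, p', ⟨hj, -⟩, hr⟩)
      · exact absurd h hne
      -- The joining paths enclose every sector except that of `e`, and the sector of `f` is not
      -- enclosed.
      · rcases hj.rightFace_mem hM hi hc hne hr hf with rfl | h
        · exact hfr
        · exact absurd (hj.region_subset h) hfr
    · intro hr
      obtain ⟨p, p', h⟩ := exists_minimalJoiningPaths hM hS hac hc.1 hc.2.1 hne
      exact Or.inr ⟨p, p', h, fun h' => hr (h.1.region_subset h')⟩

end Subgraph

namespace Subgraph

variable {S : M.Subgraph} {i : V}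

/-! ### Adding a vertex to a shrub -/

theorem reaches_add (hS : S.IsShrub) (hk : (S.edgesTo i).Nonempty) :
    ∃ r, S.IsRoot r ∧ ∀ v ∈ (S.add i).verts, (S.add i).Reaches r v := by
  obtain ⟨-, ⟨r, hroot, hr⟩, h, -⟩ := hS
  have hS' : ∀ v ∈ S.verts, S.Reaches r v := fun v hv => by
    obtain ⟨r', hr', hv⟩ := h v hv
    exact hr r' hr' ▸ hv
  refine ⟨r, hroot, ?_⟩
  rintro v (rfl | hv)
  · obtain ⟨e, he⟩ := hk
    obtain ⟨p, hp, hpT⟩ := (hS' _ he.1).add (i := v)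
    refine ⟨p ++ [e], isPath_append.2 ⟨_, hp, rfl, he.2⟩, fun g hg => ?_⟩
    rcases List.mem_append.1 hg with hg | hg
    exacts [hpT g hg, Or.inr (List.mem_singleton.1 hg ▸ he)]
  · exact (hS' v hv).add

/-- A path that uses a new edge ends at the sink `i`, hence not at `r`. -/
theorem isRoot_add (hi : i ∉ S.verts) {r : V} (hr : S.IsRoot r) : (S.add i).IsRoot r := by
  refine ⟨Or.inr hr.1, fun v hv ⟨p, hp, hpT⟩ => ?_⟩
  have hri : r ≠ i := fun h => hi (h ▸ hr.1)
  have hsrc : ∀ f ∈ p, M.src f ≠ i := fun f hf => src_ne_of_mem_add hi (hpT f hf)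
  have hpS : ∀ f ∈ p, f ∈ S.edges := by
    refine fun f hf => mem_of_mem_add (hpT f hf) fun hfi => ?_
    have hmem : i ∈ p.map M.src ++ [r] := hp.cons_map_tgt ▸
      List.mem_cons_of_mem _ (List.mem_map.2 ⟨f, hf, hfi⟩)
    rcases List.mem_append.1 hmem with h | h
    · obtain ⟨g, hg, hgi⟩ := List.mem_map.1 h
      exact hsrc g hg hgi
    · exact hri (List.mem_singleton.1 h).symm
  rcases hv with rfl | hv
  · cases p with
    | nil => exact hp
    | cons f p => exact absurd hp.1 (hsrc f (by simp))
  · exact hr.2 v hv ⟨p, hp, hpS⟩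

theorem existsUnique_isRoot_add (hS : S.IsShrub) (hi : i ∉ S.verts)
    (hk : (S.edgesTo i).Nonempty) : (∃! r, (S.add i).IsRoot r) ∧
      ∀ v ∈ (S.add i).verts, ∃ r, (S.add i).IsRoot r ∧ (S.add i).Reaches r v := by
  obtain ⟨r, hr, hreach⟩ := reaches_add hS hk
  have hr' := isRoot_add hi hr
  exact ⟨⟨r, hr', fun r' h => (h.2 r hr'.1 (hreach r' h.1)).symm⟩,
    fun v hv => ⟨r, hr', hreach v hv⟩⟩

theorem not_boundary_subset_add (hS : S.IsPreShrub) (hi : i ∉ S.verts) (F : M.Face) :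
    ¬ M.boundary F ⊆ (S.add i).edges := by
  intro hF
  refine hS.1 F fun f hf => mem_of_mem_add (hF hf) fun hfi => ?_
  rcases hf with rfl | rfl
  · exact src_ne_of_mem_add hi (hF (Or.inl (face_next true f))) ((M.src_blue f).trans hfi)
  · exact src_ne_of_mem_add hi (hF (Or.inr (face_next false f))) ((M.src_red f).trans hfi)

/-! ### Minimal joining paths -/

section Minimal

variable {e e' : E} {p p' : List E}

theorem MinimalJoiningPaths.symm (h : S.MinimalJoiningPaths i e e' p p') :
    S.MinimalJoiningPaths i e' e p' p :=
  ⟨h.1.symm, fun q q' hq hsub => by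
    rw [region_comm q, region_comm p'] at hsub ⊢
    exact h.2 q' q hq.symm hsub⟩

/-- A broken wheel in one of two minimal joining paths, with its interface in the region between
them, is the final segment of that path. -/
theorem MinimalJoiningPaths.next_eq (hM : M.IsPlanar) (hT : (S.add i).IsPreShrub)
    (hac : M.Acyclic (S.add i).edges) (hi : i ∉ S.verts) (hne : e ≠ e')
    (h : S.MinimalJoiningPaths i e e' p p') {b : Bool} {g : E}
    (hface : ∃ b', M.face b' g ∈ M.region p p') (hW : M.wheel b g ⊆ p) :
    M.next b e = g ∧ e ∈ M.wheel b g := by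
  obtain ⟨j, hbig⟩ := h.1.bigon hne
  have htwo := hbig.twoSided hM
  have hWT : ∀ f ∈ M.wheel b g, f ∈ (S.add i).edges := fun f hf => h.1.mem_add (Or.inl (hW hf))
  have hpT : ∀ f ∈ p, f ∈ (S.add i).edges := fun f hf => h.1.mem_add (Or.inl hf)
  have hpT' : ∀ f ∈ p', f ∈ (S.add i).edges := fun f hf => h.1.mem_add (Or.inr hf)
  -- If the wheel avoided `e`, the swap would keep the last edge and yield joining paths with a
  -- strictly smaller region.
  have he : e ∈ M.wheel b g := by
    by_contra he
    obtain ⟨k, -, -, -, -, hlast, hlast', -⟩ := h.1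
    obtain ⟨q, hq, hqsub, hqlast⟩ := hbig.left.exists_replace (hac.nodup_src hbig.left hpT)
      (hM.isPath_wheel b g) (hM.isPath_wheel (!b) g) (hM.wheel_ne_nil b g) hW
    obtain ⟨s, s', hs, hs', hj⟩ := exists_joiningPaths hac hq hbig.right
      (fun f hf => (hqsub f hf).elim (hT.mirror hWT f) fun h' => hpT f h'.1) hpT'
      (hqlast e hlast he) hlast'
    have hlt := htwo.enclosed_ssubset hM (B := {f | f ∈ s ∨ f ∈ s'}) (b := b) (h := g)
      (fun f hf => Or.inl (hW hf)) (fun h' => hT.not_mem hM hWT (h.1.mem_add h')) hface ?_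
    · exact hlt.2 (h.2 s s' hj hlt.1)
    · rintro f (hf | hf)
      · exact Or.inr ((hqsub f (hs.subset hf)).imp id fun h' => ⟨Or.inl h'.1, h'.2⟩)
      · exact Or.inr (Or.inr ⟨Or.inr (hs'.subset hf), fun h' =>
          hbig.disjoint (hW h') (hs'.subset hf)⟩)
  -- The successor of `e` starts at the sink `i`, so it is not in the wheel and must be the
  -- interface.
  refine ⟨(hM.next_mem_wheel_or he).resolve_right fun h' => ?_, he⟩
  obtain ⟨k, h1, -, -, -, hlast, -⟩ := h.1
  exact src_ne_of_mem_add hi (hWT _ h') ((src_next b e).trans (h1.tgt_of_getLast? hlast))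

/-- By `next_eq`, the wheel given by shrubbiness ends with `e` or `e'` and its interface leaves `i`.
The wrong colour would put both faces of that last edge into the region. The mirror image ends with
the neighbouring incoming edge at `i`, which therefore comes from `S` and is the other edge of the
pair. -/
theorem MinimalJoiningPaths.wheel_subset (hM : M.IsPlanar) (hQ : M.Shrubby)
    (hT : (S.add i).IsPreShrub) (hac : M.Acyclic (S.add i).edges) (hi : i ∉ S.verts) {n : ℕ}
    (hc : S.Consecutive i e e' n) (hne : e ≠ e') (h : S.MinimalJoiningPaths i e e' p p')
    (hr : M.rightFace e ∈ M.region p p') :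
    M.ccw e = e' ∧ (∀ c, ∀ f ∈ M.wheel c (M.blue e), f ∈ (S.add i).edges) ∧
      (M.wheel true (M.blue e) ⊆ p ∨ M.wheel false (M.blue e) ⊆ p') := by
  obtain ⟨j, hbig⟩ := h.1.bigon hne
  have htwo := hbig.twoSided hM
  obtain ⟨b, g, hface, hW⟩ := hQ.exists_wheel hbig.left hbig.right hbig.ne
  have hWT : ∀ f ∈ M.wheel b g, f ∈ (S.add i).edges := fun f hf =>
    h.1.mem_add (hW.imp (fun h => h hf) (fun h => h hf))
  have hwheels := hT.wheels hWT
  have hall : ∀ c, M.face c g ∈ M.region p p' := by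
    obtain ⟨b', hb'⟩ := hface
    exact BicoloredQuiver.face_mem_enclosed (fun h' => hT.not_mem hM hWT (h.1.mem_add h')) hb'
  have hlast : ∀ c, (M.next c).symm g ∈ (S.add i).edges := fun c =>
    hwheels c _ (List.mem_of_getLast? (hM.getLast?_wheel c g))
  rcases hW with hW | hW
  · obtain ⟨hg, heW⟩ := h.next_eq hM hT hac hi hne hface hW
    cases b with
    | false =>
      have hl : M.leftFace e ∈ M.region p p' := by
        rw [show M.leftFace e = M.face false g from (hM.mem_wheel.1 heW).1]
        exact hall false
      exact absurd hr ((htwo.2 e (Or.inl h.1.mem_left)).1 hl)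
    | true =>
      obtain rfl : M.blue e = g := hg
      refine ⟨?_, hwheels, Or.inl hW⟩
      have hmem : M.ccw e ∈ S.edgesTo i := mem_edgesTo_of_mem_add (hlast false)
        ((tgt_ccw_pow e 1).trans hc.1.2)
      have hn : n = 1 := by
        by_contra hn
        have := hc.2.2.1
        exact hc.2.2.2.2 1 one_pos (by omega) hmem
      have := hc.2.2.2.1
      rwa [hn] at this
  · obtain ⟨hg, heW⟩ := h.symm.next_eq hM hT hac hi hne.symm (region_comm p p' ▸ hface) hW
    cases b with
    | true =>
      have hl : M.leftFace e' ∈ M.region p p' := mem_enclosed_of_joined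
        (hc.joined_leftFace (fun f hf => src_ne_of_mem_add hi (h.1.mem_add hf))
          fun f hf => mem_edgesTo_of_mem_add (h.1.mem_add hf)) hr
      have hr' : M.rightFace e' ∈ M.region p p' := by
        rw [show M.rightFace e' = M.face true g from (hM.mem_wheel.1 heW).1]
        exact hall true
      exact absurd hr' ((htwo.2 e' (Or.inr h.1.symm.mem_left)).1 hl)
    | false =>
      have hg : M.red e' = g := hg
      have hn := hc.2.2.1
      have hprev : M.ccw ((M.ccw ^ (n - 1)) e) = e' := by
        rw [← ccw_pow_succ, Nat.sub_add_cancel hn, hc.2.2.2.1]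
      have hblue : M.blue ((M.ccw ^ (n - 1)) e) = g := by
        rw [← red_ccw, hprev, hg]
      have hmem : (M.ccw ^ (n - 1)) e ∈ S.edgesTo i := by
        refine mem_edgesTo_of_mem_add ?_ ((tgt_ccw_pow e _).trans hc.1.2)
        have := hlast true
        rwa [← hblue, show (M.next true).symm (M.blue ((M.ccw ^ (n - 1)) e)) = _ from
          M.blue.symm_apply_apply _] at this
      have hn1 : n - 1 = 0 := by
        by_contra hn1
        exact hc.2.2.2.2 (n - 1) (by omega) (by omega) hmem
      rw [hn1] at hprev hblue
      obtain rfl : M.blue e = g := hblue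
      exact ⟨hprev, hwheels, Or.inr hW⟩

/-- The two wheels of `blue e` contain joining paths within the region of `p` and `p'`, so these are
minimal too. By `wheel_subset` one of them is a full wheel; the other then starts at the same vertex
and is full by acyclicity. -/
theorem exists_wheels_minimal (hM : M.IsPlanar) (hQ : M.Shrubby)
    (hT : (S.add i).IsPreShrub) (hac : M.Acyclic (S.add i).edges) (hi : i ∉ S.verts) {n : ℕ}
    (hc : S.Consecutive i e e' n) (hne : e ≠ e') (h : S.MinimalJoiningPaths i e e' p p')
    (hr : M.rightFace e ∈ M.region p p') :
    S.MinimalJoiningPaths i e e' (M.blueWheel (M.blue e)) (M.redWheel (M.blue e)) := by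
  obtain ⟨hccw, hwheels, -⟩ := h.wheel_subset hM hQ hT hac hi hc hne hr
  have hsrc : M.src (M.blue e) = i := (M.src_blue e).trans hc.1.2
  have hpath : ∀ c, M.IsPath (M.tgt (M.blue e)) i (M.wheel c (M.blue e)) := fun c =>
    hsrc ▸ hM.isPath_wheel c (M.blue e)
  obtain ⟨s, s', hs, hs', hj⟩ := exists_joiningPaths (e := e) (e' := e') hac (hpath true)
    (hpath false) (hwheels true) (hwheels false)
    (by rw [hM.getLast?_wheel]; exact congrArg some (M.blue.symm_apply_apply e))
    (by
      rw [hM.getLast?_wheel, ← red_ccw, hccw]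
      exact congrArg some (M.red.symm_apply_apply e'))
  have hall : ∀ c, M.face c (M.blue e) ∈ M.region p p' :=
    BicoloredQuiver.face_mem_enclosed (b := true)
      (fun h' => src_ne_of_mem_add hi (h.1.mem_add h') hsrc) ((face_next true e).symm ▸ hr)
  have hsub : M.region s s' ⊆ M.region p p' := by
    refine enclosed_subset fun f hf => Or.inr ?_
    rcases hf with hf | hf
    · exact leftFace_eq_or (P := (· ∈ M.region p p')) (b := true)
        ((hM.mem_wheel.1 (hs.subset hf)).1 ▸ hall true)
    · exact leftFace_eq_or (P := (· ∈ M.region p p')) (b := false)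
        ((hM.mem_wheel.1 (hs'.subset hf)).1 ▸ hall false)
  have hsub' := h.2 s s' hj hsub
  have hmin : S.MinimalJoiningPaths i e e' s s' :=
    ⟨hj, fun q q' hq hqsub => hsub.trans (h.2 q q' hq (hqsub.trans hsub))⟩
  obtain ⟨-, -, hW⟩ := hmin.wheel_subset hM hQ hT hac hi hc hne (hsub' hr)
  have heq : ∀ (c : Bool) (t : List E), t <:+ M.wheel c (M.blue e) →
      M.wheel c (M.blue e) ⊆ t → t = M.wheel c (M.blue e) := fun c t ht hsub =>
    ht.eq_of_length_le ((hM.wheel_nodup c _).subperm hsub).length_le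
  have hstart : ∀ (c : Bool) (t : List E), t <:+ M.wheel c (M.blue e) →
      M.IsPath (M.tgt (M.blue e)) i t → t = M.wheel c (M.blue e) := by
    rintro c t ⟨a, ha⟩ ht
    have hW := hpath c
    rw [← ha] at hW ⊢
    obtain ⟨x, hax, hxt⟩ := isPath_append.1 hW
    have hx : x = M.tgt (M.blue e) := by
      have h1 := hxt.cons_map_tgt
      rw [← ht.cons_map_tgt] at h1
      exact (List.cons.inj h1).1
    rw [hac _ a (hx ▸ hax) fun f hf => hwheels c f (ha ▸ List.mem_append_left t hf),
      List.nil_append]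
  have hboth : s = M.wheel true (M.blue e) ∧ s' = M.wheel false (M.blue e) := by
    obtain ⟨k, hks, hks', -⟩ := hj
    have hk : ∀ (c : Bool) (t : List E), t = M.wheel c (M.blue e) → M.IsPath k i t →
        k = M.tgt (M.blue e) := by
      rintro c _ rfl ht
      have h1 := ht.cons_map_tgt
      rw [← (hpath c).cons_map_tgt] at h1
      exact (List.cons.inj h1).1
    rcases hW with hW | hW
    · have hs0 := heq true s hs hW
      exact ⟨hs0, hstart false s' hs' (hk true s hs0 hks ▸ hks')⟩
    · have hs0 := heq false s' hs' hW
      exact ⟨hstart true s hs (hk false s' hs0 hks' ▸ hks), hs0⟩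
  rwa [hboth.1, hboth.2] at hmin

end Minimal

/-! ### Addability -/

/-- Enclosed sectors are settled by `exists_wheels_minimal`. In a sector that is not enclosed, an
edge from `i` to `S` would have both ends below the root, so `S + i` would enclose it along with the
sector. -/
theorem addable_of_isShrub (hM : M.IsPlanar) (hQ : M.Shrubby) (hS : S.IsShrub)
    (hi : i ∉ S.verts) (hk : (S.edgesTo i).Nonempty) (hT : (S.add i).IsShrub) :
    S.Addable i := by
  intro e e' n hc
  have hlast := isLastPair_iff hM hQ hS hi hc
  by_cases hr : M.rightFace e ∈ M.enclosed (S.add i).edges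
  · have hnl : ¬ S.IsLastPair i e e' := fun h => hlast.1 h hr
    have hne : e ≠ e' := fun h => hnl (Or.inl h)
    have hac := hT.1.acyclic hM hQ
    obtain ⟨p, p', h⟩ := exists_minimalJoiningPaths hM hS hac hc.1 hc.2.1 hne
    have hreg : M.rightFace e ∈ M.region p p' := by
      by_contra h'
      exact hnl (Or.inr ⟨p, p', h, h'⟩)
    exact Or.inr ⟨hnl, _, _, exists_wheels_minimal hM hQ hT.1 hac hi hc hne h hreg, M.blue e,
      Or.inl ⟨rfl, rfl⟩⟩
  · refine Or.inl ⟨hlast.2 hr, fun m hm htgt => hr ?_⟩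
    obtain ⟨r, -, hreach⟩ := reaches_add hS hk
    set x := M.blue ((M.ccw ^ m) e) with hx
    have hsrc : M.src x = i := (M.src_blue _).trans ((tgt_ccw_pow e m).trans hc.1.2)
    have hface := hT.1.face_mem_enclosed hM hQ (x := x)
      (fun h => src_ne_of_mem_add hi h hsrc) (hreach _ (Or.inr htgt))
      (hsrc ▸ hreach i (Or.inl rfl)) true
    rw [hx, show M.face true (M.blue ((M.ccw ^ m) e)) = _ from face_next true _] at hface
    exact mem_enclosed_of_joined (hc.joined (fun f => src_ne_of_mem_add hi)
      (fun f => mem_edgesTo_of_mem_add) hm).1.symm hface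

/-- Comparison of last edges gives `blue e = red e'`, that is, `ccw e = e'`. With the colours
exchanged, the region would contain both faces of `e`. -/
theorem Good.wheels (hM : M.IsPlanar) {e e' : E} {n : ℕ} (hc : S.Consecutive i e e' n)
    (hg : S.Good i e e' n) (hnl : ¬ S.IsLastPair i e e') :
    n = 1 ∧ ∀ c, ∀ f ∈ M.wheel c (M.blue e), f ∈ (S.add i).edges := by
  obtain ⟨-, p, p', h, g, hp⟩ := hg.resolve_left fun h => hnl h.1
  have hne : e ≠ e' := fun h => hnl (Or.inl h)
  have hreg : M.rightFace e ∈ M.region p p' := by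
    by_contra h'
    exact hnl (Or.inr ⟨p, p', h, h'⟩)
  have hmem : ∀ {f}, f ∈ p ∨ f ∈ p' → f ∈ (S.add i).edges := h.1.mem_add
  obtain ⟨j, hbig⟩ := h.1.bigon hne
  have hjoin := h.1
  obtain ⟨k, -, -, -, -, hl, hl', -⟩ := h.1
  rcases hp with ⟨rfl, rfl⟩ | ⟨rfl, rfl⟩
  · have hbe : M.blue e = g := by
      have := Option.some_injective _ ((hM.getLast?_wheel true g).symm.trans hl)
      rw [← this]
      exact M.blue.apply_symm_apply g
    have hre : M.red e' = g := by
      have := Option.some_injective _ ((hM.getLast?_wheel false g).symm.trans hl')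
      rw [← this]
      exact M.red.apply_symm_apply g
    constructor
    · by_contra hn
      have := hc.2.2.1
      refine hc.2.2.2.2 1 one_pos (by omega) ?_
      have hccw : M.ccw e = e' := M.red.injective (by rw [red_ccw, hbe, hre])
      rw [pow_one, hccw]
      exact hc.2.1
    · subst hbe
      intro c f hf
      cases c
      exacts [hmem (Or.inr hf), hmem (Or.inl hf)]
  · have hleft : M.leftFace e ∈ M.region (M.redWheel g) (M.blueWheel g) := by
      rw [show M.leftFace e = M.face false g from
        (hM.mem_wheel (b := false).1 (List.mem_of_getLast? hl)).1]
      refine hM.face_mem_enclosed_of_wheels (fun c f hf => ?_) false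
      cases c
      exacts [Or.inl hf, Or.inr hf]
    exact absurd hreg (((hbig.twoSided hM).2 e (Or.inl hjoin.mem_left)).1 hleft)

/-- The sector that contains `h` is not that of a last pair, since goodness forbids such an edge
there; so `n = 1`, and `h` is `blue e`. -/
theorem Addable.wheels (hM : M.IsPlanar) (hk : (S.edgesTo i).Nonempty) (ha : S.Addable i) {h : E}
    (hsrc : M.src h = i) (htgt : M.tgt h ∈ S.verts) (c : Bool) :
    ∀ f ∈ M.wheel c h, f ∈ (S.add i).edges := by
  obtain ⟨g, rfl⟩ := M.blue.surjective h
  obtain ⟨e, e', n, m, hc, hm, rfl⟩ := exists_sector hM hk ((M.src_blue g).symm.trans hsrc)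
  have hg := ha e e' n hc
  obtain ⟨hn, hw⟩ := hg.wheels hM hc (by
    rcases hg with hg | hg
    exacts [absurd htgt (hg.2 m hm), hg.1])
  obtain rfl : m = 0 := by omega
  exact hw c

/-- A broken wheel that reaches the sink `i` ends there, so its interface goes from `i` to `S` and
`Addable.wheels` applies. All other broken wheels already lie in `S`. -/
theorem Addable.isPreShrub_add (hM : M.IsPlanar) (hS : S.IsPreShrub) (hi : i ∉ S.verts)
    (hk : (S.edgesTo i).Nonempty) (ha : S.Addable i) : (S.add i).IsPreShrub := by
  have key : ∀ b e, (∀ f ∈ M.wheel b e, f ∈ (S.add i).edges) →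
      ∀ f ∈ M.wheel (!b) e, f ∈ (S.add i).edges := by
    intro b e he
    by_cases hf : ∃ f ∈ M.wheel b e, M.tgt f = i
    · obtain ⟨f, hf, hfi⟩ := hf
      have hnext : M.next b f = e := (hM.next_mem_wheel_or hf).resolve_right fun h' =>
        src_ne_of_mem_add hi (he _ h') ((src_next b f).trans hfi)
      refine ha.wheels hM hk (hnext ▸ (src_next b f).trans hfi) ?_ _
      exact src_next (M := M) b e ▸ src_mem_of_mem_add (he _ (hM.next_mem_wheel b e))
    · push Not at hf
      exact fun f hf' => Or.inl (hS.mirror (fun g hg => mem_of_mem_add (he g hg) (hf g hg)) f hf')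
  exact ⟨not_boundary_subset_add hS hi, fun e => ⟨key true e, key false e⟩⟩

/-- If a face at `v` is enclosed by `S + i` but not by `S`, its component touches a new edge, hence
contains an enclosed sector at `i`. By goodness this component is made of the two faces of `blue e`,
whose vertices are all in `S + i`. -/
theorem Addable.interior_add (hM : M.IsPlanar) (hQ : M.Shrubby) (hS : S.IsShrub)
    (hi : i ∉ S.verts) (hk : (S.edgesTo i).Nonempty) (ha : S.Addable i) :
    (S.add i).interior ⊆ (S.add i).verts := by
  intro v hv
  by_contra hvT
  refine hvT (Or.inr (hS.2.2.2 ?_))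
  have key : ∀ f, (M.src f = v ∨ M.tgt f = v) → ∀ b, M.face b f ∈ M.enclosed S.edges := by
    intro f hf b
    have hT : M.face b f ∈ M.enclosed (S.add i).edges := by
      cases b
      exacts [(hv f hf).2, (hv f hf).1]
    by_contra hnS
    obtain ⟨g, hg, c, hj⟩ : ∃ g ∈ S.edgesTo i, ∃ c,
        M.Joined (S.add i).edges (M.face b f) (M.face c g) := by
      by_contra! hnone
      refine hnS (hT.subset fun G hG => ?_)
      replace hG : M.Joined S.edges (M.face b f) G := hG
      induction hG with
      | refl => exact .refl
      | tail _ hGH ih =>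
        obtain ⟨g, hg, hgf⟩ := hGH
        refine Relation.ReflTransGen.tail ih ⟨g, fun hgT => ?_, hgf⟩
        have hgi := hgT.resolve_left hg
        rcases hgf with ⟨rfl, -⟩ | ⟨rfl, -⟩
        exacts [hnone g hgi false ih, hnone g hgi true ih]
    obtain ⟨e, he, hje⟩ := exists_joined_rightFace hM hi hk (Or.inr hg.2) c
    have hjoin := hje.trans hj.symm
    have hr := mem_enclosed_of_joined (Joined.symm hjoin) hT
    obtain ⟨e', n, hc⟩ := exists_consecutive hM he
    obtain ⟨-, hw⟩ := (ha e e' n hc).wheels hM hc fun h' =>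
      (isLastPair_iff hM hQ hS hi hc).1 h' hr
    have hsrc : M.src (M.blue e) = i := (M.src_blue e).trans he.2
    have hends : ∀ c, M.src (M.blue e) ∈ (S.add i).verts ∧ M.tgt (M.blue e) ∈ (S.add i).verts ∧
        ∀ f ∈ M.wheel c (M.blue e), f ∈ (S.add i).edges := fun c =>
      ⟨Or.inl hsrc, src_next (M := M) c (M.blue e) ▸
        (S.add i).src_mem _ (hw c _ (hM.next_mem_wheel c _)), hw c⟩
    have hfb : M.face b f = M.face b (M.blue e) := by
      rw [← show M.face true (M.blue e) = M.rightFace e from face_next true e] at hjoin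
      rcases hM.eq_or_eq_of_joined hw hjoin with h' | h'
      · cases b
        exacts [absurd h' (leftFace_ne_rightFace _ _), h']
      · cases b
        exacts [h', absurd h'.symm (leftFace_ne_rightFace _ _)]
    obtain ⟨h1, h2, h3⟩ := hends b
    refine hvT ?_
    rcases List.mem_cons.1 (hM.mem_loop.2 hfb) with rfl | hfw
    · rcases hf with rfl | rfl
      exacts [h1, h2]
    · rcases hf with rfl | rfl
      exacts [(S.add i).src_mem f (h3 f hfw), (S.add i).tgt_mem f (h3 f hfw)]
  exact fun f hf => ⟨key f hf true, key f hf false⟩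

theorem isShrub_add_iff (hM : M.IsPlanar) (hQ : M.Shrubby) (hS : S.IsShrub)
    (hi : i ∉ S.verts) (hk : (S.edgesTo i).Nonempty) :
    (S.add i).IsShrub ↔ S.Addable i := by
  refine ⟨addable_of_isShrub hM hQ hS hi hk, fun ha => ?_⟩
  obtain ⟨h1, h2⟩ := existsUnique_isRoot_add hS hi hk
  exact ⟨ha.isPreShrub_add hM hS.1 hi hk, h1, h2, ha.interior_add hM hQ hS hi hk⟩

end Subgraph

end BicoloredQuiver

/-! ### Planarity of the universal cover of the torus -/

namespace PeriodicQuiver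

variable {I E : Type*} (Q : PeriodicQuiver I E)

theorem liftPerm_iterate (π : Equiv.Perm E) (n : ℕ) (x : E × (ℤ × ℤ)) :
    (Q.liftPerm π)^[n] x =
      (π^[n] x.1, x.2 + ∑ k ∈ Finset.range n, Q.shift (π^[k] x.1)) := by
  induction n with
  | zero => simp
  | succ n ih =>
    rw [Function.iterate_succ_apply', ih, Function.iterate_succ_apply', Finset.sum_range_succ,
      ← add_assoc]
    rfl

theorem mem_periodicPts_liftPerm [Finite E] {π : Equiv.Perm E}
    (h : ∀ e, ∑ k ∈ Finset.range (Function.minimalPeriod π e), Q.shift (π^[k] e) = 0)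
    (x : E × (ℤ × ℤ)) : x ∈ Function.periodicPts (Q.liftPerm π) := by
  refine ⟨Function.minimalPeriod π x.1, Function.minimalPeriod_pos_of_mem_periodicPts
    (π.injective.mem_periodicPts x.1), ?_⟩
  rw [Function.IsPeriodicPt, Function.IsFixedPt, liftPerm_iterate, h,
    Function.iterate_minimalPeriod, add_zero]

end PeriodicQuiver

theorem TorusQuiver.isPlanar {I E : Type*} [Finite I] [Finite E] [Nonempty E]
    (Q : TorusQuiver I E) : Q.universalCover.IsPlanar where
  blue_periodic := Q.mem_periodicPts_liftPerm Q.blue_closed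
  red_periodic := Q.mem_periodicPts_liftPerm Q.red_closed
  finite_in v := by
    refine (Set.finite_range fun e : E => (e, v.2 - Q.shift e)).subset ?_
    rintro ⟨e, n⟩ rfl
    exact ⟨e, by simp [PeriodicQuiver.cover]⟩
  connected := Q.cover_connected
  simplyConnected := Q.cover_simplyConnected
  infinite_face := by
    by_contra hfin
    rw [not_infinite_iff_finite] at hfin
    have hper := Q.mem_periodicPts_liftPerm Q.blue_closed
    -- The cover has infinitely many edges, but each blue face has only finitely many.
    refine Set.infinite_univ (α := E × (ℤ × ℤ)) (Set.Finite.preimage'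
      (f := Q.universalCover.rightFace) (s := Set.univ) Set.finite_univ fun F _ => ?_)
    obtain ⟨F⟩ | ⟨F⟩ := F
    · obtain ⟨e, rfl⟩ := Quotient.exists_rep F
      refine ((Set.finite_lt_nat (Function.minimalPeriod (Q.liftPerm Q.blue) e)).image
        fun m => (Q.liftPerm Q.blue)^[m] e).subset fun f hf => ?_
      obtain ⟨m, hm, rfl⟩ := BicoloredQuiver.exists_iterate_eq_of_sameCycle (hper e)
        (BicoloredQuiver.face_eq_iff (M := Q.universalCover) (b := true).1 hf).symm
      exact ⟨m, hm, rfl⟩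
    · exact Set.finite_empty.subset fun f hf => Sum.inl_ne_inr hf

theorem mainTheorem8 {I E : Type*} [Finite I] [Finite E] (Q : TorusQuiver I E)
    (hQ : Q.IsShrubby) (S : Q.universalCover.Subgraph) (hS : S.IsShrub)
    (i : I × (ℤ × ℤ)) (hi : i ∉ S.verts) (hk : (S.edgesTo i).Nonempty) :
    (S.add i).IsShrub ↔ S.Addable i := by
  have : Nonempty E := ⟨hk.some.1⟩
  exact BicoloredQuiver.Subgraph.isShrub_add_iff Q.isPlanar hQ hS hi hk
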